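/- Let $\varepsilon$ be a positive real number. Then for almost all natural numbers $n$ with $4\nmid n$ and $n\not\equiv 7\pmod 8$, the equation $$n=x_1^2+x_2^2+x_3^2$$ has a solution in positive integers $x_1,x_2,x_3$ with $$x_3\le (\log n)(\log\log n)^{2+\varepsilon}.$$ Here "almost all" means that, among the natural numbers $n\le N$ with $4\nmid n$ and $n\not\equiv 7\pmod 8$, the proportion of those for which there is no such solution tends to $0$ as $N\to\infty$. -/

import Mathlib

open Filter Topology

/-- The number of positive integers `n ≤ N` that belong to `A`. -/
noncomputable def countUpTo (A : Set ℕ) (N : ℕ) : ℕ :=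
  Set.ncard {n : ℕ | n ∈ A ∧ 1 ≤ n ∧ n ≤ N}

/-- Almost all natural numbers `n` belonging to `S` satisfy `P`: among the `n ≤ N` in `S`, the
proportion of those for which `P n` fails tends to `0` as `N → ∞`. -/
def ForAlmostAll (S : Set ℕ) (P : ℕ → Prop) : Prop :=
  Tendsto (fun N : ℕ => (countUpTo {n | n ∈ S ∧ ¬ P n} N : ℝ) / (countUpTo S N : ℝ))
    atTop (𝓝 0)

/-- The natural numbers not divisible by `4` and not congruent to `7` modulo `8`. -/
def eligible : Set ℕ := {n | 1 ≤ n ∧ ¬ 4 ∣ n ∧ ¬ n ≡ 7 [MOD 8]}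

/-- `n = x₁² + x₂² + x₃²` for some positive integers `x₁, x₂, x₃` with `x₃ ≤ Y`. -/
def HasMicrosquareRep (n : ℕ) (Y : ℝ) : Prop :=
  ∃ x₁ x₂ x₃ : ℕ, 0 < x₁ ∧ 0 < x₂ ∧ 0 < x₃ ∧ n = x₁ ^ 2 + x₂ ^ 2 + x₃ ^ 2 ∧ (x₃ : ℝ) ≤ Y

/-! ### Counting in residue classes -/

/-! The proof is a second moment argument in short blocks. Cut the integers into blocks (X², (X+Z)²]
with Z = X/k, and split each block into residue classes modulo 2M, the product of 8 and the odd
primes up to w. A class containing an eligible integer contains a value x₀² + y₀² + h² with y₀ prime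
to M. Consider the values x² + y² + (h + 2Mi)² with x in (X, X+Z], y ≤ Y and i < J, where x and y
lie in the classes of x₀ modulo 2M and y₀ modulo M, Y is about X / log X, and J is about log X · log
log X. Cauchy–Schwarz (`card_sq_le_card_image_mul_energy`) shows that these values cover almost the
whole class once the number of coincidences between them is at most 1 + O(1/w) times its expected
size.

For a coincidence with u < x, put x − u = 2Mb, x + u = 2w, y + v = 2z and v − y = 2Ms. The equation
becomes bw = sz + E, where 4ME is the difference of the two small squares. For fixed z and b this is
a congruence for w modulo z (`card_fibre_le`). Summing over b leaves the common divisors of z and E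
(`card_coincidences_le`).

If i = j then E = 0, every divisor of z counts, and a logarithm is lost; this loss is harmless
because J / log X → ∞. If i ≠ j, the divisor 1 gives the expected main term. Every other common
divisor is prime to M, hence exceeds w, and on average over i and j these contribute only O(1/w)
(`sum_coprimeDivSum_squareGap_le`).

Letting X → ∞ and then choosing k and w large makes the exceptional proportion of each block
arbitrarily small (`tendsto_defect`), and `card_le_of_block_bounds` passes from blocks to all n ≤ N.
The third variable is at most 2MJ, and a spare factor log log n absorbs the constant 2M. -/

lemma card_Ioc_modEq_le (A B m v : ℕ) (hm : 0 < m) :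
    (((Finset.Ioc A (A + B)).filter (fun x => x ≡ v [MOD m])).card : ℝ) ≤ B / m + 1 := by
  have h := Nat.Ioc_filter_modEq_card (a := A) (b := A + B) hm v
  have hm' : (0 : ℚ) < m := by exact_mod_cast hm
  have key : ((((Finset.Ioc A (A + B)).filter (fun x => x ≡ v [MOD m])).card : ℤ) : ℚ)
      ≤ B / m + 1 := by
    rw [h, Int.cast_max]
    apply max_le
    · push_cast
      have h1 := Int.floor_le (((A : ℚ) + B - v) / m)
      have h2 := Int.lt_floor_add_one (((A : ℚ) - v) / m)
      have h3 : ((A : ℚ) + B - v) / m = (A - v) / m + B / m := by ring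
      linarith
    · push_cast; positivity
  have key' : ((((Finset.Ioc A (A + B)).filter (fun x => x ≡ v [MOD m])).card : ℚ) : ℝ)
      ≤ ((B / m + 1 : ℚ) : ℝ) := by exact_mod_cast key
  push_cast at key'
  exact key'

lemma le_card_Ioc_modEq (A B m v : ℕ) (hm : 0 < m) :
    (B : ℝ) / m - 1 ≤ ((Finset.Ioc A (A + B)).filter (fun x => x ≡ v [MOD m])).card := by
  have h := Nat.Ioc_filter_modEq_card (a := A) (b := A + B) hm v
  have key : (B : ℚ) / m - 1 ≤
      ((((Finset.Ioc A (A + B)).filter (fun x => x ≡ v [MOD m])).card : ℤ) : ℚ) := by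
    rw [h, Int.cast_max]
    apply le_max_of_le_left
    push_cast
    have h1 := Int.floor_le (((A : ℚ) - v) / m)
    have h2 := Int.lt_floor_add_one (((A : ℚ) + B - v) / m)
    have h3 : ((A : ℚ) + B - v) / m = (A - v) / m + B / m := by ring
    linarith
  have key' : ((B / m - 1 : ℚ) : ℝ) ≤
      ((((Finset.Ioc A (A + B)).filter (fun x => x ≡ v [MOD m])).card : ℚ) : ℝ) := by
    exact_mod_cast key
  push_cast at key'
  exact key'

lemma card_le_of_pairwise_modEq (S : Finset ℕ) (A B m : ℕ) (hm : 0 < m)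
    (hS : ∀ a ∈ S, A < a ∧ a ≤ A + B) (h : ∀ a ∈ S, ∀ b ∈ S, a ≡ b [MOD m]) :
    (S.card : ℝ) ≤ B / m + 1 := by
  rcases S.eq_empty_or_nonempty with rfl | ⟨v, hv⟩
  · simp; positivity
  · refine le_trans ?_ (card_Ioc_modEq_le A B m v hm)
    exact_mod_cast Finset.card_le_card fun a ha => by
      simp only [Finset.mem_filter, Finset.mem_Ioc]
      exact ⟨hS a ha, h a ha v hv⟩

lemma card_Icc_dvd_le (n d : ℕ) :
    (((Finset.Icc 1 n).filter (fun x => d ∣ x)).card : ℝ) ≤ n / d := by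
  have : ((Finset.Icc 1 n).filter (fun x => d ∣ x)).card = n / d := Nat.Ioc_filter_dvd_card_eq_div n d
  rw [this]
  exact Nat.cast_div_le

lemma sum_inv_Icc_le (n : ℕ) : ∑ d ∈ Finset.Icc 1 n, (1 : ℝ) / d ≤ 1 + Real.log n := by
  have h := harmonic_le_one_add_log n
  rw [harmonic_eq_sum_Icc] at h
  push_cast at h
  simpa only [one_div] using h

lemma sum_card_divisors_le (n : ℕ) :
    ∑ z ∈ Finset.Icc 1 n, (z.divisors.card : ℝ) ≤ n * (1 + Real.log n) := by
  have h1 : ∀ z ∈ Finset.Icc 1 n,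
      (z.divisors.card : ℝ) = ∑ d ∈ Finset.Icc 1 n, if d ∣ z then (1 : ℝ) else 0 := by
    intro z hz
    rw [Finset.mem_Icc] at hz
    rw [← Finset.sum_filter, Finset.sum_const, nsmul_eq_mul, mul_one]
    congr 2
    ext d
    simp only [Nat.mem_divisors, Finset.mem_filter, Finset.mem_Icc]
    constructor
    · rintro ⟨hd, -⟩
      exact ⟨⟨Nat.pos_of_dvd_of_pos hd hz.1, (Nat.le_of_dvd hz.1 hd).trans hz.2⟩, hd⟩
    · rintro ⟨-, hd⟩
      exact ⟨hd, by omega⟩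
  rw [Finset.sum_congr rfl h1, Finset.sum_comm]
  calc _ ≤ ∑ d ∈ Finset.Icc 1 n, (n : ℝ) * (1 / d) := by
        apply Finset.sum_le_sum
        intro d _
        rw [← Finset.sum_filter, Finset.sum_const, nsmul_eq_mul, mul_one, mul_one_div]
        exact card_Icc_dvd_le n d
    _ ≤ _ := by
        rw [← Finset.mul_sum]
        exact mul_le_mul_of_nonneg_left (sum_inv_Icc_le n) (Nat.cast_nonneg n)

/-! ### The tent function along an arithmetic progression -/

/-- Removing both end points from the tent of width Y + 2 leaves the tent of width Y raised by 1,
which suits induction in steps of two. -/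
lemma four_mul_sum_min_le (Y : ℕ) :
    4 * ∑ z ∈ Finset.range (Y + 1), min z (Y - z) ≤ Y ^ 2 := by
  induction Y using Nat.twoStepInduction with
  | zero => simp
  | one => decide
  | more n ih _ =>
    rw [Finset.sum_range_succ, Finset.sum_range_succ']
    have : ∑ k ∈ Finset.range (n + 1), min (k + 1) (n + 2 - (k + 1))
        = ∑ k ∈ Finset.range (n + 1), (min k (n - k) + 1) := by
      apply Finset.sum_congr rfl
      intro k hk
      rw [Finset.mem_range] at hk
      omega
    rw [this, Finset.sum_add_distrib]
    simp
    nlinarith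

/-- The tent is 1-Lipschitz, so M times its value at z is at most its sum over the window [z, z + M)
plus M². Windows starting in one residue class are disjoint, so together they cost at most the full
sum Y²/4. -/
lemma sum_min_modEq_le (M Y v : ℕ) (hM : 0 < M) :
    ∑ z ∈ (Finset.Icc 1 Y).filter (fun z => z ≡ v [MOD M]), ((min z (Y - z) : ℕ) : ℝ)
      ≤ (Y : ℝ) ^ 2 / (4 * M) + Y + M := by
  set S := (Finset.Icc 1 Y).filter (fun z => z ≡ v [MOD M]) with hS
  let f : ℕ → ℕ := fun z => min z (Y - z)
  have hMr : (0 : ℝ) < M := by exact_mod_cast hM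
  have h1 : ∀ z ∈ S, (M : ℝ) * f z ≤ (∑ r ∈ Finset.range M, (f (z + r) : ℝ)) + M * M := by
    intro z _
    have : ∀ r ∈ Finset.range M, (f z : ℝ) ≤ f (z + r) + M := by
      intro r hr
      rw [Finset.mem_range] at hr
      have : f z ≤ f (z + r) + M := by simp only [f]; omega
      exact_mod_cast this
    have := Finset.sum_le_sum this
    rw [Finset.sum_add_distrib] at this
    simpa using this
  have h2 : ∑ z ∈ S, ∑ r ∈ Finset.range M, (f (z + r) : ℝ)
      ≤ ∑ t ∈ Finset.range (Y + 1), (f t : ℝ) := by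
    rw [← Finset.sum_product']
    have hz : ∑ t ∈ Finset.range (Y + 1), (f t : ℝ) = ∑ t ∈ Finset.range (Y + M + 1), (f t : ℝ) := by
      apply Finset.sum_subset
      · intro t; simp only [Finset.mem_range]; omega
      · intro t _ ht
        rw [Finset.mem_range] at ht
        have : f t = 0 := by simp only [f]; omega
        simp [this]
    rw [hz]
    have hinj : Set.InjOn (fun p : ℕ × ℕ => p.1 + p.2) (S ×ˢ Finset.range M : Finset (ℕ × ℕ)) := by
      rintro ⟨a, r⟩ ha ⟨b, s⟩ hb hab
      simp only [Finset.coe_product, Set.mem_prod, Finset.mem_coe, hS, Finset.mem_filter,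
        Finset.mem_range] at ha hb hab
      have hab' : a ≡ b [MOD M] := ha.1.2.trans hb.1.2.symm
      have hrs : r ≡ s [MOD M] := by
        have : a + r ≡ b + s [MOD M] := by rw [hab]
        exact Nat.ModEq.add_left_cancel hab' this
      have := Nat.ModEq.eq_of_lt_of_lt hrs ha.2 hb.2
      ext <;> simp <;> omega
    rw [← Finset.sum_image (f := fun t => (f t : ℝ)) hinj]
    apply Finset.sum_le_sum_of_subset_of_nonneg
    · intro t ht
      simp only [Finset.mem_image, Finset.mem_product, hS, Finset.mem_filter, Finset.mem_Icc,
        Finset.mem_range, Prod.exists] at ht ⊢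
      omega
    · intros; positivity
  have h3 : ∑ t ∈ Finset.range (Y + 1), (f t : ℝ) ≤ (Y : ℝ) ^ 2 / 4 := by
    have := four_mul_sum_min_le Y
    have h' : (4 : ℝ) * ∑ t ∈ Finset.range (Y + 1), (f t : ℝ) ≤ (Y : ℝ) ^ 2 := by exact_mod_cast this
    linarith
  have h4 : (S.card : ℝ) ≤ Y / M + 1 := by
    have := card_Ioc_modEq_le 0 Y M v hM
    rw [zero_add] at this
    exact this
  have h5 : (M : ℝ) * ∑ z ∈ S, (f z : ℝ) ≤ (Y : ℝ) ^ 2 / 4 + (Y / M + 1) * (M * M) := by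
    rw [Finset.mul_sum]
    refine (Finset.sum_le_sum h1).trans ?_
    rw [Finset.sum_add_distrib, Finset.sum_const, nsmul_eq_mul]
    have : (S.card : ℝ) * (M * M) ≤ (Y / M + 1) * (M * M) :=
      mul_le_mul_of_nonneg_right h4 (by positivity)
    linarith
  have h6 : (Y : ℝ) ^ 2 / 4 + (Y / M + 1) * (M * M) = M * ((Y : ℝ) ^ 2 / (4 * M) + Y + M) := by
    field_simp
    ring
  rw [h6] at h5
  exact le_of_mul_le_mul_left h5 hMr

/-! ### Local solubility -/

/-- `n` is a sum of three squares modulo `m`, the second of which is prime to `m`. -/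
def LocallySoluble (n m : ℕ) : Prop :=
  ∃ x y h : ℕ, x ^ 2 + y ^ 2 + h ^ 2 ≡ n [MOD m] ∧ y.Coprime m

lemma LocallySoluble.mul {n a b : ℕ} (hab : a.Coprime b) (ha : LocallySoluble n a)
    (hb : LocallySoluble n b) : LocallySoluble n (a * b) := by
  obtain ⟨x, y, h, e, c⟩ := ha
  obtain ⟨x', y', h', e', c'⟩ := hb
  obtain ⟨x₁, hx, hx'⟩ := Nat.chineseRemainder hab x x'
  obtain ⟨y₁, hy, hy'⟩ := Nat.chineseRemainder hab y y'
  obtain ⟨h₁, hh, hh'⟩ := Nat.chineseRemainder hab h h'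
  refine ⟨x₁, y₁, h₁, ?_, ?_⟩
  · rw [← Nat.modEq_and_modEq_iff_modEq_mul hab]
    exact ⟨(((hx.pow 2).add (hy.pow 2)).add (hh.pow 2)).trans e,
      (((hx'.pow 2).add (hy'.pow 2)).add (hh'.pow 2)).trans e'⟩
  · apply Nat.Coprime.mul_right
    · rw [Nat.Coprime, hy.gcd_eq]; exact c
    · rw [Nat.Coprime, hy'.gcd_eq]; exact c'

/-- Only the residues 1, 2, 3, 5, 6 remain, and each is reached with y = 1. -/
lemma locallySoluble_eight {n : ℕ} (hn : n ∈ eligible) : LocallySoluble n 8 := by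
  obtain ⟨-, h4, h7⟩ := hn
  simp only [Nat.ModEq] at h7
  have : n % 8 = 1 ∨ n % 8 = 2 ∨ n % 8 = 3 ∨ n % 8 = 5 ∨ n % 8 = 6 := by omega
  rcases this with h | h | h | h | h
  · exact ⟨0, 1, 0, by simp [Nat.ModEq, h], by decide⟩
  · exact ⟨0, 1, 1, by simp [Nat.ModEq, h], by decide⟩
  · exact ⟨1, 1, 1, by simp [Nat.ModEq, h], by decide⟩
  · exact ⟨0, 1, 2, by simp [Nat.ModEq, h], by decide⟩
  · exact ⟨1, 1, 2, by simp [Nat.ModEq, h], by decide⟩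

/-- Choose h with n − h² nonzero modulo p and write it as a sum of two squares. The two roots cannot
both vanish, so a nonzero one can serve as y. -/
lemma locallySoluble_prime (n : ℕ) {p : ℕ} (hp : p.Prime) : LocallySoluble n p := by
  have := Fact.mk hp
  obtain ⟨h, hh⟩ : ∃ h : ZMod p, (n : ZMod p) - h ^ 2 ≠ 0 := by
    by_cases h0 : (n : ZMod p) = 0
    · exact ⟨1, by simp [h0]⟩
    · exact ⟨0, by simpa using h0⟩
  obtain ⟨a, b, hab⟩ := ZMod.sq_add_sq p ((n : ZMod p) - h ^ 2)
  have key : ∀ a b : ZMod p, a ^ 2 + b ^ 2 = n - h ^ 2 → b ≠ 0 → LocallySoluble n p := by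
    intro a b hab hb
    refine ⟨a.val, b.val, h.val, ?_, ?_⟩
    · rw [← ZMod.natCast_eq_natCast_iff]
      push_cast
      simp only [ZMod.natCast_val, ZMod.cast_id', id_eq]
      rw [hab]; ring
    · rw [Nat.coprime_comm, hp.coprime_iff_not_dvd, ← ZMod.natCast_eq_zero_iff]
      simpa using hb
  by_cases hb : b = 0
  · refine key b a (by rw [add_comm]; exact hab) ?_
    rintro rfl
    rw [hb] at hab
    simp at hab
    exact hh hab.symm
  · exact key a b hab hb

/-- The product of `8` and the odd primes up to `w`. -/
def sieveModulus (w : ℕ) : ℕ := 8 * ∏ p ∈ (Finset.Icc 3 w).filter Nat.Prime, p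

lemma sieveModulus_pos (w : ℕ) : 0 < sieveModulus w := by
  refine Nat.mul_pos (by norm_num) (Finset.prod_pos fun p hp => ?_)
  exact (Finset.mem_filter.1 hp).2.pos

lemma locallySoluble_sieveModulus (w : ℕ) {n : ℕ} (hn : n ∈ eligible) :
    LocallySoluble n (sieveModulus w) := by
  have key : ∀ S : Finset ℕ, (∀ p ∈ S, p.Prime ∧ 3 ≤ p) → LocallySoluble n (8 * ∏ p ∈ S, p) := by
    intro S
    induction S using Finset.induction_on with
    | empty => intro _; simpa using locallySoluble_eight hn
    | insert q S hq ih =>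
      intro h
      rw [Finset.prod_insert hq, mul_left_comm]
      obtain ⟨hqp, hq3⟩ := h q (Finset.mem_insert_self q S)
      refine LocallySoluble.mul ?_ (locallySoluble_prime n hqp)
        (ih fun p hp => h p (Finset.mem_insert_of_mem hp))
      refine Nat.Coprime.mul_right ?_ (Nat.Coprime.prod_right fun p hp => ?_)
      · exact Nat.Coprime.pow_right 3 ((Nat.coprime_primes hqp Nat.prime_two).2 (by omega))
      · exact (Nat.coprime_primes hqp (h p (Finset.mem_insert_of_mem hp)).1).2
          fun e => hq (e ▸ hp)
  refine key _ fun p hp => ?_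
  simp only [Finset.mem_filter, Finset.mem_Icc] at hp
  exact ⟨hp.2, hp.1.1⟩

lemma lt_of_coprime_sieveModulus {w d : ℕ} (hd : 1 < d) (hc : d.Coprime (sieveModulus w)) :
    w < d := by
  by_contra! hw
  have hp := Nat.minFac_prime (n := d) (by omega)
  have hpd := Nat.minFac_dvd d
  have hle := Nat.le_of_dvd (by omega) hpd
  have hdvd : d.minFac ∣ sieveModulus w := by
    rcases Nat.lt_or_ge d.minFac 3 with h3 | h3
    · have h2 : d.minFac = 2 := by have := hp.two_le; omega
      rw [h2]
      exact Dvd.dvd.mul_right (by norm_num) _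
    · refine Dvd.dvd.mul_left (Finset.dvd_prod_of_mem (fun p => p) ?_) _
      simp only [Finset.mem_filter, Finset.mem_Icc]
      exact ⟨⟨h3, by omega⟩, hp⟩
  exact hp.one_lt.ne' (Nat.dvd_one.1 (hc ▸ Nat.dvd_gcd hpd hdvd))

/-! ### Sums over divisors prime to a modulus -/

/-- The sum of `1 / d` over the divisors `d` of `n` that are prime to `M`. -/
noncomputable def coprimeDivSum (M n : ℕ) : ℝ :=
  ∑ d ∈ n.divisors.filter (fun d => d.Coprime M), (1 : ℝ) / d

lemma one_le_coprimeDivSum (M : ℕ) {n : ℕ} (hn : n ≠ 0) : 1 ≤ coprimeDivSum M n := by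
  have h1 : 1 ∈ n.divisors.filter (fun d => d.Coprime M) := by simp [hn]
  have := Finset.single_le_sum (f := fun d : ℕ => (1 : ℝ) / d) (fun d _ => by positivity) h1
  simpa [coprimeDivSum] using this

/-- Every divisor of ab factors as a divisor of a times a divisor of b; repeated products only
enlarge the right side. -/
lemma coprimeDivSum_mul_le (M a b : ℕ) :
    coprimeDivSum M (a * b) ≤ coprimeDivSum M a * coprimeDivSum M b := by
  unfold coprimeDivSum
  rw [Finset.sum_mul_sum, ← Finset.sum_product']
  have himg : (a * b).divisors.filter (fun d => d.Coprime M) ⊆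
      ((a.divisors.filter (fun d => d.Coprime M)) ×ˢ
        (b.divisors.filter (fun d => d.Coprime M))).image (fun p => p.1 * p.2) := by
    intro d hd
    simp only [Finset.mem_filter, Nat.mem_divisors] at hd
    obtain ⟨⟨hdvd, hne⟩, hc⟩ := hd
    obtain ⟨d₁, d₂, h₁, h₂, rfl⟩ := (Nat.dvd_mul).1 hdvd
    simp only [Finset.mem_image, Finset.mem_product, Finset.mem_filter, Nat.mem_divisors]
    exact ⟨(d₁, d₂), ⟨⟨⟨h₁, left_ne_zero_of_mul hne⟩, hc.coprime_mul_right⟩,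
      ⟨h₂, right_ne_zero_of_mul hne⟩, hc.coprime_mul_left⟩, rfl⟩
  refine (Finset.sum_le_sum_of_subset_of_nonneg himg fun _ _ _ => by positivity).trans ?_
  refine (Finset.sum_image_le_of_nonneg (fun _ _ => by positivity)).trans (le_of_eq ?_)
  refine Finset.sum_congr rfl fun p _ => ?_
  push_cast
  rw [div_mul_div_comm, one_mul]

lemma coprimeDivSum_sub_one_eq (M : ℕ) {n : ℕ} (hn : n ≠ 0) :
    coprimeDivSum M n - 1 =
      ∑ d ∈ n.divisors.filter (fun d => d.Coprime M ∧ 1 < d), (1 : ℝ) / d := by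
  have h1 : 1 ∈ n.divisors.filter (fun d => d.Coprime M) := by simp [hn]
  rw [coprimeDivSum, ← Finset.add_sum_erase _ _ h1]
  simp only [Nat.cast_one, div_one, add_sub_cancel_left]
  refine Finset.sum_congr ?_ fun _ _ => rfl
  ext d
  simp only [Finset.mem_erase, Finset.mem_filter, Nat.mem_divisors]
  constructor
  · rintro ⟨h, ⟨hd, -⟩, hc⟩
    have := Nat.pos_of_dvd_of_pos hd (Nat.pos_of_ne_zero hn)
    exact ⟨⟨hd, hn⟩, hc, by omega⟩
  · rintro ⟨hd, hc, h⟩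
    exact ⟨by omega, hd, hc⟩

lemma card_range_dvd_progression_le {d m : ℕ} (c J : ℕ) (hd : 0 < d) (hc : d.Coprime m) :
    (((Finset.range J).filter (fun i => d ∣ c + m * i)).card : ℝ) ≤ J / d + 1 := by
  rw [← Finset.card_map (addRightEmbedding 1)]
  apply card_le_of_pairwise_modEq _ 0 J d hd
  · intro a ha
    simp only [Finset.mem_map, Finset.mem_filter, Finset.mem_range, addRightEmbedding_apply] at ha
    omega
  · intro a ha b hb
    simp only [Finset.mem_map, Finset.mem_filter, Finset.mem_range, addRightEmbedding_apply]
      at ha hb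
    obtain ⟨i, ⟨-, hi⟩, rfl⟩ := ha
    obtain ⟨j, ⟨-, hj⟩, rfl⟩ := hb
    have h1 : c + m * i ≡ c + m * j [MOD d] :=
      ((Nat.modEq_zero_iff_dvd).2 hi).trans ((Nat.modEq_zero_iff_dvd).2 hj).symm
    exact (Nat.ModEq.cancel_left_of_coprime hc (Nat.ModEq.add_left_cancel' c h1)).add_right 1

/-- Exchange the sums: each d prime to M divides at most J/d + 1 terms of the progression, with
weight 1/d. As d > w, the sum of J/d² is at most J/w, and the sum of 1/d up to R gives 1 + log R. -/
lemma sum_coprimeDivSum_sub_one_le {M w m : ℕ} (c J R : ℕ) (hw : 1 ≤ w)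
    (hM : ∀ d : ℕ, 1 < d → d.Coprime M → w < d) (hm : ∀ d : ℕ, d.Coprime M → d.Coprime m)
    (hR : ∀ i < J, c + m * i ≤ R) (hc : 1 ≤ c) :
    ∑ i ∈ Finset.range J, (coprimeDivSum M (c + m * i) - 1) ≤ J / w + 1 + Real.log R := by
  set D := (Finset.Icc 1 R).filter (fun d => d.Coprime M ∧ 1 < d) with hD
  have h1 : ∀ i ∈ Finset.range J, coprimeDivSum M (c + m * i) - 1
      ≤ ∑ d ∈ D, if d ∣ c + m * i then (1 : ℝ) / d else 0 := by
    intro i hi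
    rw [Finset.mem_range] at hi
    rw [coprimeDivSum_sub_one_eq M (by omega), ← Finset.sum_filter]
    apply Finset.sum_le_sum_of_subset_of_nonneg
    · intro d
      simp only [hD, Finset.mem_filter, Nat.mem_divisors, Finset.mem_Icc]
      rintro ⟨⟨hd, h0⟩, h2, h3⟩
      exact ⟨⟨⟨h3.le, (Nat.le_of_dvd (by omega) hd).trans (hR i hi)⟩, h2, h3⟩, hd⟩
    · intros; positivity
  refine (Finset.sum_le_sum h1).trans ?_
  rw [Finset.sum_comm]
  have h2 : ∀ d ∈ D, ∑ i ∈ Finset.range J, (if d ∣ c + m * i then (1 : ℝ) / d else 0)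
      ≤ J * ((d : ℝ) ^ 2)⁻¹ + 1 / d := by
    intro d hd
    simp only [hD, Finset.mem_filter, Finset.mem_Icc] at hd
    rw [← Finset.sum_filter, Finset.sum_const, nsmul_eq_mul]
    have := card_range_dvd_progression_le c J (by omega) (hm d hd.2.1)
    have hd0 : (0 : ℝ) < d := by exact_mod_cast hd.1.1
    calc _ ≤ ((J : ℝ) / d + 1) * (1 / d) := mul_le_mul_of_nonneg_right this (by positivity)
      _ = _ := by field_simp
  refine (Finset.sum_le_sum h2).trans ?_
  rw [Finset.sum_add_distrib, ← Finset.mul_sum, add_assoc]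
  have hsub : D ⊆ Finset.Ioc w R := by
    intro d
    simp only [hD, Finset.mem_filter, Finset.mem_Icc, Finset.mem_Ioc]
    rintro ⟨⟨_, h⟩, h2, h3⟩
    exact ⟨hM d h3 h2, h⟩
  apply add_le_add
  · rw [div_eq_mul_inv]
    refine mul_le_mul_of_nonneg_left ?_ (Nat.cast_nonneg J)
    refine (Finset.sum_le_sum_of_subset_of_nonneg hsub fun _ _ _ => by positivity).trans ?_
    rcases le_total w R with h | h
    · refine (sum_Ioc_inv_sq_le_sub (by omega) h).trans ?_
      simp
    · rw [Finset.Ioc_eq_empty_of_le h]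
      simp
  · exact (Finset.sum_le_sum_of_subset_of_nonneg (Finset.filter_subset _ _)
      fun _ _ _ => by positivity).trans (sum_inv_Icc_le R)

/-- The integer `|h_j² - h_i²| / (4 M)`, where `h_i = h + 2 M i`. -/
def squareGap (M h i j : ℕ) : ℕ := ((j - i) + (i - j)) * (h + M * (i + j))

lemma squareGap_comm (M h i j : ℕ) : squareGap M h i j = squareGap M h j i := by
  unfold squareGap
  rw [add_comm (j - i), add_comm i j]

lemma squareGap_ne_zero {M h i j : ℕ} (hh : 1 ≤ h) (hij : i ≠ j) : squareGap M h i j ≠ 0 := by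
  unfold squareGap
  apply mul_ne_zero <;> omega

/-- For j = i + 1 + k the gap factors as (1 + k)(h + M(1 + k) + 2Mi). The first factor depends on k
alone and, for fixed k, the second runs through a progression in i, so submultiplicativity reduces
the double sum to averages along progressions. -/
lemma sum_coprimeDivSum_squareGap_le {M w h : ℕ} (J R : ℕ) (hw : 1 ≤ w) (hM2 : 2 ∣ M)
    (hM : ∀ d : ℕ, 1 < d → d.Coprime M → w < d) (hh : 1 ≤ h) (hJ : J ≤ R)
    (hR : h + 3 * M * J ≤ R) :
    ∑ i ∈ Finset.range J, ∑ j ∈ (Finset.range J).erase i,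
      (coprimeDivSum M (squareGap M h i j) - 1) ≤
    2 * ((J / w + 1 + Real.log R) * (2 * J + (J / w + 1 + Real.log R))) := by
  set A : ℝ := J / w + 1 + Real.log R with hA
  let t : ℕ → ℕ → ℝ := fun i j => coprimeDivSum M (squareGap M h i j) - 1
  have hA0 : 0 ≤ A := by
    have := Real.log_natCast_nonneg R
    positivity
  have hsplit : ∀ i ∈ Finset.range J, ∑ j ∈ (Finset.range J).erase i, t i j =
      ∑ j ∈ Finset.range J, (if i < j then t i j else 0)
        + ∑ j ∈ Finset.range J, (if j < i then t j i else 0) := by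
    intro i hi
    rw [← Finset.sum_filter, ← Finset.sum_filter, ← Finset.sum_filter_add_sum_filter_not
      ((Finset.range J).erase i) (fun j => i < j)]
    congr 1
    · refine Finset.sum_congr ?_ fun _ _ => rfl
      ext j; simp only [Finset.mem_filter, Finset.mem_erase, Finset.mem_range]; omega
    · refine Finset.sum_congr ?_ fun j _ => ?_
      · ext j; simp only [Finset.mem_filter, Finset.mem_erase, Finset.mem_range]; omega
      · simp only [t]; rw [squareGap_comm]
  change ∑ i ∈ Finset.range J, ∑ j ∈ (Finset.range J).erase i, t i j ≤ _
  rw [Finset.sum_congr rfl hsplit, Finset.sum_add_distrib]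
  have hsym : ∑ i ∈ Finset.range J, ∑ j ∈ Finset.range J, (if j < i then t j i else 0)
      = ∑ i ∈ Finset.range J, ∑ j ∈ Finset.range J, (if i < j then t i j else 0) :=
    Finset.sum_comm
  rw [hsym, ← two_mul]
  apply mul_le_mul_of_nonneg_left _ (by norm_num)
  let b : ℕ → ℕ → ℕ := fun k i => (h + M * (1 + k)) + 2 * M * i
  let f := coprimeDivSum M
  have hf : ∀ {n : ℕ}, n ≠ 0 → 1 ≤ f n := fun hn => one_le_coprimeDivSum M hn
  have hb0 : ∀ k i, b k i ≠ 0 := fun k i => by simp only [b]; omega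
  have hinner : ∀ i ∈ Finset.range J, ∑ j ∈ Finset.range J, (if i < j then t i j else 0)
      ≤ ∑ k ∈ Finset.range J, (f (1 + k) * f (b k i) - 1) := by
    intro i hi
    have e : (Finset.range J).filter (fun j => i < j) = Finset.Ico (i + 1) J := by
      ext j; simp only [Finset.mem_filter, Finset.mem_range, Finset.mem_Ico]; omega
    rw [← Finset.sum_filter, e, Finset.sum_Ico_eq_sum_range]
    have hnn : ∀ k, 0 ≤ f (1 + k) * f (b k i) - 1 := fun k => by
      have := one_le_mul_of_one_le_of_one_le (hf (n := 1 + k) (by omega)) (hf (hb0 k i))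
      linarith
    refine le_trans ?_ (Finset.sum_le_sum_of_subset_of_nonneg
      (s := Finset.range (J - (i + 1))) (by intro k; simp only [Finset.mem_range]; omega)
      fun k _ _ => hnn k)
    apply Finset.sum_le_sum
    intro k _
    have : squareGap M h i (i + 1 + k) = (1 + k) * b k i := by
      simp only [squareGap, b]
      have : i + 1 + k - i + (i - (i + 1 + k)) = 1 + k := by omega
      rw [this]; ring
    simp only [t, this]
    linarith [coprimeDivSum_mul_le M (1 + k) (b k i)]
  refine (Finset.sum_le_sum hinner).trans ?_
  rw [Finset.sum_comm]
  have hB : ∀ k ∈ Finset.range J, ∑ i ∈ Finset.range J, (f (b k i) - 1) ≤ A := by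
    intro k hk
    rw [Finset.mem_range] at hk
    refine sum_coprimeDivSum_sub_one_le _ J R hw hM (fun d hd => ?_) (fun i hi => ?_) (by omega)
    · exact Nat.Coprime.mul_right (Nat.Coprime.coprime_dvd_right hM2 hd) hd
    · have h1 : M * (1 + k) ≤ M * J := Nat.mul_le_mul_left M (by omega)
      have h2 : 2 * M * i ≤ 2 * M * J := Nat.mul_le_mul_left _ hi.le
      nlinarith
  have hC : ∑ k ∈ Finset.range J, (f (1 + k) - 1) ≤ A := by
    have := sum_coprimeDivSum_sub_one_le (M := M) (m := 1) 1 J R hw hM (fun d _ => by simp)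
      (fun i hi => by omega) le_rfl
    simpa using this
  calc ∑ k ∈ Finset.range J, ∑ i ∈ Finset.range J, (f (1 + k) * f (b k i) - 1)
      ≤ ∑ k ∈ Finset.range J, ((f (1 + k) - 1) * (J + A) + A) := by
        apply Finset.sum_le_sum
        intro k hk
        have h1 := hB k hk
        have h2 := hf (n := 1 + k) (by omega)
        -- This is ab − 1 = (a − 1)b + (b − 1), summed over i.
        have h3 : ∑ i ∈ Finset.range J, (f (1 + k) * f (b k i) - 1)
            = (f (1 + k) - 1) * (J + ∑ i ∈ Finset.range J, (f (b k i) - 1))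
              + ∑ i ∈ Finset.range J, (f (b k i) - 1) := by
          rw [mul_add, Finset.mul_sum, add_assoc, ← Finset.sum_add_distrib]
          have : (f (1 + k) - 1) * (J : ℝ) = ∑ _i ∈ Finset.range J, (f (1 + k) - 1) := by
            simp only [Finset.sum_const, Finset.card_range, nsmul_eq_mul]; ring
          rw [this, ← Finset.sum_add_distrib]
          exact Finset.sum_congr rfl fun i _ => by ring
        rw [h3]
        have : (f (1 + k) - 1) * (J + ∑ i ∈ Finset.range J, (f (b k i) - 1))
            ≤ (f (1 + k) - 1) * (J + A) :=
          mul_le_mul_of_nonneg_left (by linarith) (by linarith)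
        linarith
    _ ≤ A * (2 * J + A) := by
        rw [Finset.sum_add_distrib, ← Finset.sum_mul, Finset.sum_const, Finset.card_range,
          nsmul_eq_mul]
        have : (∑ k ∈ Finset.range J, (f (1 + k) - 1)) * (J + A) ≤ A * (J + A) :=
          mul_le_mul_of_nonneg_right hC (by positivity)
        linarith

/-! ### The weighted sum over the large variable -/

/-- The sum bounding the number of off-diagonal coincidences with square gap `e`. -/
noncomputable def gapSum (M Y y₀ e : ℕ) : ℝ :=
  ∑ z ∈ (Finset.Icc 1 Y).filter (fun z => z ≡ y₀ [MOD M]),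
    ((min z (Y - z) : ℕ) / (M : ℝ) + e / z) * (z.divisors.filter (fun d => d ∣ e)).card

/-- With zero gap the divisor condition is empty and the full divisor function appears. This
logarithm is what forces J to outgrow log X. -/
lemma gapSum_zero_le (M Y y₀ : ℕ) (hM : 0 < M) :
    gapSum M Y y₀ 0 ≤ (Y : ℝ) ^ 2 * (1 + Real.log Y) := by
  unfold gapSum
  have hMr : (1 : ℝ) ≤ M := by exact_mod_cast hM
  calc _ ≤ ∑ z ∈ (Finset.Icc 1 Y).filter (fun z => z ≡ y₀ [MOD M]), (Y : ℝ) * z.divisors.card := by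
        apply Finset.sum_le_sum
        intro z hz
        have h1 : ((min z (Y - z) : ℕ) : ℝ) ≤ Y := by
          have : min z (Y - z) ≤ Y := by omega
          exact_mod_cast this
        have h2 : ((min z (Y - z) : ℕ) : ℝ) / M ≤ Y := (div_le_self (by positivity) hMr).trans h1
        simpa using mul_le_mul_of_nonneg_right h2 (Nat.cast_nonneg z.divisors.card)
    _ ≤ ∑ z ∈ Finset.Icc 1 Y, (Y : ℝ) * z.divisors.card :=
        Finset.sum_le_sum_of_subset_of_nonneg (Finset.filter_subset _ _)
          fun _ _ _ => by positivity
    _ ≤ _ := by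
        rw [← Finset.mul_sum, sq, mul_assoc]
        exact mul_le_mul_of_nonneg_left (sum_card_divisors_le Y) (Nat.cast_nonneg Y)

/-- Each z in the class is prime to M, so a common divisor of z and e is either 1, giving the main
term Y²/(4M²), or some d > 1 prime to M. For the latter, z lies in one class modulo Md, which has
density 1/(Md). -/
lemma gapSum_le {M Y y₀ e : ℕ} (hM : 0 < M) (hY : 0 < Y) (he : e ≠ 0) (hy : y₀.Coprime M) :
    gapSum M Y y₀ e ≤ (Y : ℝ) ^ 2 / (4 * M ^ 2)
      + (Y : ℝ) ^ 2 / M ^ 2 * (coprimeDivSum M e - 1) + 4 * Y * e := by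
  set S := (Finset.Icc 1 Y).filter (fun z => z ≡ y₀ [MOD M]) with hS
  set D := e.divisors.filter (fun d => d.Coprime M ∧ 1 < d) with hD
  have hMr : (1 : ℝ) ≤ M := by exact_mod_cast hM
  have hM0 : (0 : ℝ) < M := by linarith
  have hYr : (1 : ℝ) ≤ Y := by exact_mod_cast hY
  have her : (1 : ℝ) ≤ e := by exact_mod_cast Nat.pos_of_ne_zero he
  have hcop : ∀ z ∈ S, z.Coprime M := by
    intro z hz
    rw [hS, Finset.mem_filter] at hz
    rw [Nat.Coprime, hz.2.gcd_eq]
    exact hy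
  have hpt : ∀ z ∈ S, ((min z (Y - z) : ℕ) / (M : ℝ) + e / z)
        * (z.divisors.filter (fun d => d ∣ e)).card ≤
      (min z (Y - z) : ℕ) / (M : ℝ) + (Y : ℝ) / M * (∑ d ∈ D, if d ∣ z then (1 : ℝ) else 0)
        + e := by
    intro z hz
    have hz' := hz
    rw [hS, Finset.mem_filter, Finset.mem_Icc] at hz'
    have hz0 : (0 : ℝ) < z := by exact_mod_cast hz'.1.1
    have h1 : (z.divisors.filter (fun d => d ∣ e)).card ≤ 1 + (D.filter (fun d => d ∣ z)).card := by
      have hsub : z.divisors.filter (fun d => d ∣ e) ⊆ insert 1 (D.filter (fun d => d ∣ z)) := by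
        intro d
        simp only [hD, Finset.mem_filter, Nat.mem_divisors, Finset.mem_insert]
        rintro ⟨⟨hdz, hz0⟩, hde⟩
        have := Nat.pos_of_dvd_of_pos hde (Nat.pos_of_ne_zero he)
        by_cases h : d = 1
        · exact Or.inl h
        · exact Or.inr ⟨⟨⟨hde, he⟩, Nat.Coprime.coprime_dvd_left hdz (hcop z hz), by omega⟩, hdz⟩
      refine (Finset.card_le_card hsub).trans ((Finset.card_insert_le _ _).trans ?_)
      omega
    -- The trivial divisor bound is enough for the term e / z.
    have h2 : (z.divisors.filter (fun d => d ∣ e)).card ≤ z :=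
      (Finset.card_filter_le _ _).trans (Nat.card_divisors_le_self z)
    have h1' : ((z.divisors.filter (fun d => d ∣ e)).card : ℝ)
        ≤ 1 + (D.filter (fun d => d ∣ z)).card := by exact_mod_cast h1
    have h2' : ((z.divisors.filter (fun d => d ∣ e)).card : ℝ) ≤ z := by exact_mod_cast h2
    have h3 : ((min z (Y - z) : ℕ) : ℝ) ≤ Y := by
      have : min z (Y - z) ≤ Y := by omega
      exact_mod_cast this
    rw [← Finset.sum_filter, Finset.sum_const, nsmul_eq_mul, mul_one, add_mul]
    apply add_le_add
    · have h4 : ((min z (Y - z) : ℕ) : ℝ) / M ≤ Y / M := by gcongr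
      have h5 : (0 : ℝ) ≤ (min z (Y - z) : ℕ) / M := by positivity
      have h6 : (0 : ℝ) ≤ (D.filter (fun d => d ∣ z)).card := by positivity
      nlinarith [mul_le_mul_of_nonneg_left h1' h5, mul_le_mul_of_nonneg_right h4 h6]
    · calc _ ≤ (e : ℝ) / z * z := mul_le_mul_of_nonneg_left h2' (by positivity)
        _ = e := by field_simp
  unfold gapSum
  refine (Finset.sum_le_sum hpt).trans ?_
  rw [Finset.sum_add_distrib, Finset.sum_add_distrib]
  have hfirst : ∑ z ∈ S, ((min z (Y - z) : ℕ) : ℝ) / M ≤ (Y : ℝ) ^ 2 / (4 * M ^ 2) + 2 * Y * e := by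
    rw [← Finset.sum_div, div_le_iff₀ hM0]
    refine (sum_min_modEq_le M Y y₀ hM).trans ?_
    have : ((Y : ℝ) ^ 2 / (4 * M ^ 2) + 2 * Y * e) * M = (Y : ℝ) ^ 2 / (4 * M) + 2 * Y * e * M := by
      field_simp
    rw [this]
    have h1 : (1 : ℝ) ≤ e * M := one_le_mul_of_one_le_of_one_le her hMr
    have h2 : (Y : ℝ) * 1 ≤ Y * (e * M) := by gcongr
    have h3 : (1 : ℝ) ≤ Y * e := one_le_mul_of_one_le_of_one_le hYr her
    nlinarith
  have hcard : ∀ d ∈ D, ((S.filter (fun z => d ∣ z)).card : ℝ) ≤ Y / (M * d : ℕ) + 1 := by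
    intro d hd
    simp only [hD, Finset.mem_filter, Nat.mem_divisors] at hd
    apply card_le_of_pairwise_modEq _ 0 Y (M * d) (Nat.mul_pos hM (by omega))
    · intro a ha
      simp only [hS, Finset.mem_filter, Finset.mem_Icc] at ha
      omega
    · intro a ha b hb
      simp only [hS, Finset.mem_filter] at ha hb
      rw [← Nat.modEq_and_modEq_iff_modEq_mul hd.2.1.symm]
      exact ⟨ha.1.2.trans hb.1.2.symm,
        ((Nat.modEq_zero_iff_dvd).2 ha.2).trans ((Nat.modEq_zero_iff_dvd).2 hb.2).symm⟩
  have hDcard : (D.card : ℝ) ≤ e := by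
    exact_mod_cast (Finset.card_filter_le _ _).trans (Nat.card_divisors_le_self e)
  have hsecond : ∑ z ∈ S, (Y : ℝ) / M * (∑ d ∈ D, if d ∣ z then (1 : ℝ) else 0)
      ≤ (Y : ℝ) ^ 2 / M ^ 2 * (coprimeDivSum M e - 1) + Y * e := by
    rw [← Finset.mul_sum, Finset.sum_comm, coprimeDivSum_sub_one_eq M he]
    have h1 : ∑ d ∈ D, ∑ z ∈ S, (if d ∣ z then (1 : ℝ) else 0)
        ≤ ∑ d ∈ D, ((Y : ℝ) / M * (1 / d) + 1) := by
      apply Finset.sum_le_sum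
      intro d hd
      rw [← Finset.sum_filter, Finset.sum_const, nsmul_eq_mul, mul_one]
      refine (hcard d hd).trans (le_of_eq ?_)
      push_cast
      rw [div_mul_div_comm, mul_one]
    rw [Finset.sum_add_distrib, ← Finset.mul_sum, Finset.sum_const, nsmul_eq_mul, mul_one] at h1
    have h2 : (Y : ℝ) / M ≤ Y := div_le_self (by linarith) hMr
    have h3 : (Y : ℝ) / M * D.card ≤ Y * e := by gcongr
    calc _ ≤ (Y : ℝ) / M * (Y / M * ∑ d ∈ D, (1 : ℝ) / d + D.card) :=
          mul_le_mul_of_nonneg_left h1 (by positivity)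
      _ = (Y : ℝ) ^ 2 / M ^ 2 * ∑ d ∈ D, (1 : ℝ) / d + Y / M * D.card := by
          field_simp
      _ ≤ _ := by linarith
  have hthird : ∑ _z ∈ S, (e : ℝ) ≤ Y * e := by
    rw [Finset.sum_const, nsmul_eq_mul]
    gcongr
    refine (Finset.card_filter_le _ _).trans ?_
    simp
  linarith

/-! ### Coincidences between values of the ternary form -/

/-- Pairs `(x, y)` with `x` in `(X, X + Z]` and `y` in `[1, Y]`, in fixed residue classes. -/
def boxPairs (M X Y Z x₀ y₀ : ℕ) : Finset (ℕ × ℕ) :=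
  (Finset.Ioc X (X + Z)).filter (fun x => x ≡ x₀ [MOD 2 * M]) ×ˢ
    (Finset.Icc 1 Y).filter (fun y => y ≡ y₀ [MOD M])

lemma mem_boxPairs {M X Y Z x₀ y₀ : ℕ} {p : ℕ × ℕ} : p ∈ boxPairs M X Y Z x₀ y₀ ↔
    ((X < p.1 ∧ p.1 ≤ X + Z) ∧ p.1 ≡ x₀ [MOD 2 * M]) ∧
      ((1 ≤ p.2 ∧ p.2 ≤ Y) ∧ p.2 ≡ y₀ [MOD M]) := by
  simp [boxPairs, Finset.mem_product]

/-- Coincidences `x² + y² + h_i² = u² + v² + h_j²` with `u < x`. -/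
def coincidences (M X Y Z x₀ y₀ h i j : ℕ) : Finset ((ℕ × ℕ) × (ℕ × ℕ)) :=
  (boxPairs M X Y Z x₀ y₀ ×ˢ boxPairs M X Y Z x₀ y₀).filter (fun p => p.2.1 < p.1.1 ∧
    p.1.1 ^ 2 + p.1.2 ^ 2 + (h + 2 * M * i) ^ 2 = p.2.1 ^ 2 + p.2.2 ^ 2 + (h + 2 * M * j) ^ 2)

/-- The signed version of `squareGap`. -/
def signedGap (M h i j : ℕ) : ℤ := ((j : ℤ) - i) * (h + M * (i + j))

lemma natAbs_signedGap (M h i j : ℕ) : (signedGap M h i j).natAbs = squareGap M h i j := by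
  unfold signedGap squareGap
  rw [Int.natAbs_mul]
  congr 1
  all_goals omega

lemma exists_params_of_coincidence {M x y u v x₀ y₀ h i j : ℕ} (h4 : 4 ∣ M) (hM : 0 < M)
    (hy₀ : y₀.Coprime M) (hx : x ≡ x₀ [MOD 2 * M]) (hu : u ≡ x₀ [MOD 2 * M])
    (hy : y ≡ y₀ [MOD M]) (hv : v ≡ y₀ [MOD M]) (hux : u < x)
    (heq : x ^ 2 + y ^ 2 + (h + 2 * M * i) ^ 2 = u ^ 2 + v ^ 2 + (h + 2 * M * j) ^ 2) :
    ∃ (b w z : ℕ) (s : ℤ), 0 < b ∧ x = w + M * b ∧ u + M * b = w ∧ (y : ℤ) = z - M * s ∧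
      (v : ℤ) = z + M * s ∧ (b * w : ℤ) = s * z + signedGap M h i j := by
  have hyodd : ¬ 2 ∣ y := by
    intro h2
    have h2M : 2 ∣ M := (by norm_num : (2 : ℕ) ∣ 4).trans h4
    have : y.Coprime M := by rw [Nat.Coprime, hy.gcd_eq]; exact hy₀
    have := Nat.dvd_gcd h2 h2M
    rw [Nat.Coprime] at *
    omega
  obtain ⟨m, rfl⟩ := h4
  obtain ⟨b, hb⟩ : 2 * (4 * m) ∣ x - u := (Nat.modEq_iff_dvd' hux.le).1 (hu.trans hx.symm)
  obtain ⟨s', hs'⟩ : ((4 * m : ℕ) : ℤ) ∣ (v : ℤ) - y := (hy.trans hv.symm).dvd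
  have hb0 : 0 < b := by
    rcases Nat.eq_zero_or_pos b with rfl | h
    · omega
    · exact h
  have hm0 : (m : ℤ) ≠ 0 := by omega
  have hxn : x = u + 2 * (4 * m) * b := by omega
  have hxz : (x : ℤ) = u + 2 * (4 * m) * b := by
    exact_mod_cast hxn
  have hvz : (v : ℤ) = y + 4 * m * s' := by push_cast at hs'; linarith
  have heqz : (x : ℤ) ^ 2 + y ^ 2 + (h + 2 * (4 * m) * i) ^ 2
      = u ^ 2 + v ^ 2 + (h + 2 * (4 * m) * j) ^ 2 := by exact_mod_cast heq
  have key : s' * (2 * y + 4 * m * s') = 4 * (b * (u + 4 * m * b) - signedGap (4 * m) h i j) := by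
    rw [hxz, hvz] at heqz
    have : (4 * m : ℤ) * (s' * (2 * y + 4 * m * s'))
        = (4 * m) * (4 * (b * (u + 4 * m * b) - signedGap (4 * m) h i j)) := by
      unfold signedGap
      push_cast
      linear_combination -heqz
    exact mul_left_cancel₀ (by omega) this
  -- Since y is odd, `key` forces s' to be even. Hence the half-sum z is an integer, congruent to y₀
  -- modulo M.
  obtain ⟨s, rfl⟩ : (2 : ℤ) ∣ s' := by
    have h1 : (2 : ℤ) ∣ s' * y :=
      ⟨b * (u + 4 * m * b) - signedGap (4 * m) h i j - m * s' ^ 2, by linarith⟩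
    rcases Int.prime_two.dvd_or_dvd h1 with h | h
    · exact h
    · exact absurd (by exact_mod_cast h) hyodd
  have hz0 : 0 ≤ (y : ℤ) + 4 * m * s := by
    have : (0 : ℤ) ≤ v := Int.natCast_nonneg v
    have : (0 : ℤ) ≤ y := Int.natCast_nonneg y
    linarith
  obtain ⟨z, hz⟩ := Int.eq_ofNat_of_zero_le hz0
  refine ⟨b, u + 4 * m * b, z, s, hb0, by rw [hxn]; ring, rfl, ?_, ?_, ?_⟩
  · push_cast; linarith
  · push_cast; linarith
  · rw [← hz]; push_cast
    linarith

/-- The admissible values of `w = (x + u) / 2` for given `z` and `b`. -/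
def fibre (M X Z x₀ z b : ℕ) (E : ℤ) : Finset ℕ :=
  (Finset.Ioc X (X + Z)).filter (fun w => w ≡ x₀ + M * b [MOD 2 * M] ∧ (z : ℤ) ∣ b * w - E)

/-- The congruence bw ≡ E modulo z requires gcd(z, b) ∣ E and then fixes w modulo z / gcd(z, b).
That modulus is prime to 2M, so it combines with the class of w modulo 2M. -/
lemma card_fibre_le {M X Z x₀ z b : ℕ} {E : ℤ} (hM : 0 < M) (hM2 : 2 ∣ M) (hz : 0 < z)
    (hzM : z.Coprime M) :
    ((fibre M X Z x₀ z b E).card : ℝ) ≤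
      if z.gcd b ∣ E.natAbs then (Z : ℝ) * z.gcd b / (2 * M * z) + 1 else 0 := by
  split_ifs with hd
  · set d := z.gcd b with hdef
    have hd0 : 0 < d := Nat.gcd_pos_of_pos_left b hz
    obtain ⟨q, hq⟩ : d ∣ z := Nat.gcd_dvd_left z b
    have hq0 : 0 < q := by rcases Nat.eq_zero_or_pos q with rfl | h; · omega
                           · exact h
    have hqM : q.Coprime (2 * M) := by
      have h1 : q.Coprime M := Nat.Coprime.coprime_dvd_left ⟨d, by rw [hq, mul_comm]⟩ hzM
      exact Nat.Coprime.mul_right (Nat.Coprime.coprime_dvd_right hM2 h1) h1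
    have := card_le_of_pairwise_modEq (fibre M X Z x₀ z b E) X Z (2 * M * q)
      (by positivity) (fun a ha => by
        simpa [Finset.mem_Ioc] using (Finset.mem_filter.1 ha).1) (fun a ha a' ha' => by
        obtain ⟨-, ha1, ha2⟩ := Finset.mem_filter.1 ha
        obtain ⟨-, ha1', ha2'⟩ := Finset.mem_filter.1 ha'
        rw [← Nat.modEq_and_modEq_iff_modEq_mul hqM.symm]
        refine ⟨ha1.trans ha1'.symm, ?_⟩
        have h1 : b * a ≡ b * a' [MOD z] := by
          rw [Nat.modEq_iff_dvd]
          have := dvd_sub ha2' ha2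
          push_cast
          rwa [sub_sub_sub_cancel_right] at this
        have h2 := Nat.ModEq.cancel_left_div_gcd hz h1
        rwa [← hdef, hq, Nat.mul_div_cancel_left q hd0] at h2)
    refine this.trans (le_of_eq ?_)
    have hd' : (d : ℝ) ≠ 0 := by positivity
    rw [hq]
    push_cast
    field_simp
  · have : fibre M X Z x₀ z b E = ∅ := by
      rw [Finset.eq_empty_iff_forall_notMem]
      intro w hw
      obtain ⟨-, -, h⟩ := Finset.mem_filter.1 hw
      apply hd
      have h1 : ((z.gcd b : ℕ) : ℤ) ∣ z := by exact_mod_cast Nat.gcd_dvd_left z b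
      have h2 : ((z.gcd b : ℕ) : ℤ) ∣ b := by exact_mod_cast Nat.gcd_dvd_right z b
      have h3 : ((z.gcd b : ℕ) : ℤ) ∣ E := (dvd_sub_right (h2.mul_right _)).1 (h1.trans h)
      exact Int.natCast_dvd.1 h3
    rw [this]; simp

/-- Bound the gcd by the sum of all common divisors d of z, e and b; each d then contributes d · (B
/ d) at most. -/
lemma sum_gcd_le (z e : ℕ) (hz : 0 < z) (B : ℕ) :
    ∑ b ∈ Finset.Icc 1 B, (if z.gcd b ∣ e then (z.gcd b : ℝ) else 0)
      ≤ B * (z.divisors.filter (fun d => d ∣ e)).card := by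
  set D := z.divisors.filter (fun d => d ∣ e) with hD
  have h1 : ∀ b ∈ Finset.Icc 1 B, (if z.gcd b ∣ e then (z.gcd b : ℝ) else 0)
      ≤ ∑ d ∈ D, if d ∣ b then (d : ℝ) else 0 := by
    intro b _
    split_ifs with h
    · have hmem : z.gcd b ∈ D := by
        simp only [hD, Finset.mem_filter, Nat.mem_divisors]
        exact ⟨⟨Nat.gcd_dvd_left z b, hz.ne'⟩, h⟩
      have := Finset.single_le_sum (f := fun d : ℕ => if d ∣ b then (d : ℝ) else 0)
        (fun d _ => by positivity) hmem
      simpa [Nat.gcd_dvd_right z b] using this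
    · positivity
  refine (Finset.sum_le_sum h1).trans ?_
  rw [Finset.sum_comm]
  have h2 : ∀ d ∈ D, ∑ b ∈ Finset.Icc 1 B, (if d ∣ b then (d : ℝ) else 0) ≤ B := by
    intro d hd
    simp only [hD, Finset.mem_filter, Nat.mem_divisors] at hd
    have hd0 : (0 : ℝ) < d := by exact_mod_cast Nat.pos_of_dvd_of_pos hd.1.1 hz
    rw [← Finset.sum_filter, Finset.sum_const, nsmul_eq_mul]
    calc _ ≤ (B : ℝ) / d * d := mul_le_mul_of_nonneg_right (card_Icc_dvd_le B d) hd0.le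
      _ = B := by field_simp
  refine (Finset.sum_le_sum h2).trans (le_of_eq ?_)
  rw [Finset.sum_const, nsmul_eq_mul, mul_comm]

/-- The map to (z, b, w) is injective: bw = sz + E recovers s because z ≠ 0, and then x, y, u, v
follow. The range of b comes from X ≤ w. -/
lemma card_coincidences_le_sum {M X Y Z x₀ y₀ h i j : ℕ} (h4 : 4 ∣ M) (hM : 0 < M) (hX : 0 < X)
    (hy₀ : y₀.Coprime M) :
    (coincidences M X Y Z x₀ y₀ h i j).card ≤
      ∑ z ∈ (Finset.Icc 1 Y).filter (fun z => z ≡ y₀ [MOD M]),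
        ∑ b ∈ Finset.Icc 1 ⌊((z : ℝ) * (min z (Y - z) : ℕ) / M + squareGap M h i j) / X⌋₊,
          (fibre M X Z x₀ z b (signedGap M h i j)).card := by
  set E := signedGap M h i j with hE
  let B : ℕ → ℕ := fun z => ⌊((z : ℝ) * (min z (Y - z) : ℕ) / M + squareGap M h i j) / X⌋₊
  let target : Finset (Σ _ : (Σ _ : ℕ, ℕ), ℕ) :=
    (((Finset.Icc 1 Y).filter (fun z => z ≡ y₀ [MOD M])).sigma
      (fun z => Finset.Icc 1 (B z))).sigma (fun p => fibre M X Z x₀ p.1 p.2 E)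
  have hcard : target.card = ∑ z ∈ (Finset.Icc 1 Y).filter (fun z => z ≡ y₀ [MOD M]),
        ∑ b ∈ Finset.Icc 1 (B z), (fibre M X Z x₀ z b E).card := by
    simp only [target, Finset.card_sigma, Finset.sum_sigma]
  rw [← hcard]
  let g : (ℕ × ℕ) × (ℕ × ℕ) → (Σ _ : (Σ _ : ℕ, ℕ), ℕ) := fun p =>
    ⟨⟨(p.1.2 + p.2.2) / 2, (p.1.1 - p.2.1) / (2 * M)⟩, (p.1.1 + p.2.1) / 2⟩
  have hpar : ∀ p ∈ coincidences M X Y Z x₀ y₀ h i j, ∃ (b w z : ℕ) (s : ℤ), 0 < b ∧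
      p.1.1 = w + M * b ∧ p.2.1 + M * b = w ∧ (p.1.2 : ℤ) = z - M * s ∧
      (p.2.2 : ℤ) = z + M * s ∧ (b * w : ℤ) = s * z + E ∧ g p = ⟨⟨z, b⟩, w⟩ := by
    rintro ⟨⟨x, y⟩, ⟨u, v⟩⟩ hp
    simp only [coincidences, Finset.mem_filter, Finset.mem_product, mem_boxPairs] at hp
    obtain ⟨⟨⟨⟨_, hx⟩, _, hy⟩, ⟨_, hu⟩, _, hv⟩, hux, heq⟩ := hp
    obtain ⟨b, w, z, s, hb, h1, h2, h3, h5, h6⟩ :=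
      exists_params_of_coincidence h4 hM hy₀ hx hu hy hv hux heq
    refine ⟨b, w, z, s, hb, h1, h2, h3, h5, h6, ?_⟩
    have e1 : (y + v) / 2 = z := by omega
    have e2 : (x - u) / (2 * M) = b := by
      have : x - u = 2 * M * b := by rw [mul_assoc]; omega
      rw [this, Nat.mul_div_cancel_left _ (by omega)]
    have e3 : (x + u) / 2 = w := by omega
    simp only [g, e1, e2, e3]
  apply Finset.card_le_card_of_injOn g
  · rintro p hp
    obtain ⟨b, w, z, s, hb, h1, h2, h3, h5, h6, hg⟩ := hpar p hp
    obtain ⟨⟨x, y⟩, ⟨u, v⟩⟩ := p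
    simp only at h1 h2 h3 h5
    simp only [coincidences, Finset.mem_coe, Finset.mem_filter, Finset.mem_product,
      mem_boxPairs] at hp
    obtain ⟨⟨⟨⟨⟨hx1, hx2⟩, hx⟩, ⟨hy1, hy2⟩, hy⟩, ⟨⟨hu1, hu2⟩, hu⟩, ⟨hv1, hv2⟩, hv⟩, hux, heq⟩ := hp
    rw [hg]
    simp only [target, Finset.mem_coe, Finset.mem_sigma, Finset.mem_filter, Finset.mem_Icc, fibre,
      Finset.mem_Ioc]
    have hzY : 1 ≤ z ∧ z ≤ Y := by omega
    have hMr : (0 : ℝ) < M := by exact_mod_cast hM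
    have hXr : (0 : ℝ) < X := by exact_mod_cast hX
    refine ⟨⟨⟨hzY, ?_⟩, hb, ?_⟩, ⟨by omega, by omega⟩, ?_, ?_⟩
    · refine Nat.ModEq.trans ?_ hy
      rw [Nat.modEq_iff_dvd]
      exact ⟨-s, by rw [h3]; ring⟩
    · apply Nat.le_floor
      rw [le_div_iff₀ hXr]
      -- The two bounds are y = z − Ms ≥ 1 and v = z + Ms ≤ Y.
      have hmin : (M : ℤ) * s ≤ (min z (Y - z) : ℕ) := by omega
      have hbw : (b * X : ℤ) ≤ b * w := by
        have : X ≤ w := by omega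
        exact_mod_cast Nat.mul_le_mul_left b this
      have hEabs : E ≤ (squareGap M h i j : ℤ) := by
        rw [← natAbs_signedGap, hE]; exact Int.le_natAbs
      have hbz : (M : ℤ) * (b * X) ≤ z * (min z (Y - z) : ℕ) + M * squareGap M h i j := by
        have hz0 : (0 : ℤ) ≤ z := Int.natCast_nonneg z
        have hM0 : (0 : ℤ) ≤ M := Int.natCast_nonneg M
        calc (M : ℤ) * (b * X) ≤ M * (s * z + E) := by
              rw [← h6]; exact mul_le_mul_of_nonneg_left hbw hM0
          _ = z * (M * s) + M * E := by ring
          _ ≤ _ := add_le_add (mul_le_mul_of_nonneg_left hmin hz0)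
              (mul_le_mul_of_nonneg_left hEabs hM0)
      have hbz' : (M : ℝ) * (b * X) ≤ z * (min z (Y - z) : ℕ) + M * squareGap M h i j := by
        exact_mod_cast hbz
      rw [div_add' _ _ _ hMr.ne', le_div_iff₀ hMr]
      linarith
    · rw [← h2]
      exact hu.add_right _
    · exact ⟨s, by rw [h6]; ring⟩
  · rintro p hp q hq hpq
    obtain ⟨b, w, z, s, hb, h1, h2, h3, h5, h6, hg⟩ := hpar p hp
    obtain ⟨b', w', z', s', hb', h1', h2', h3', h5', h6', hg'⟩ := hpar q hq
    rw [hg, hg'] at hpq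
    simp only [Sigma.mk.injEq, heq_eq_eq] at hpq
    obtain ⟨⟨rfl, rfl⟩, rfl⟩ := hpq
    have hp1 := (Finset.mem_product.1 (Finset.mem_filter.1 hp).1).1
    have hp2 := (Finset.mem_product.1 (Finset.mem_filter.1 hp).1).2
    rw [mem_boxPairs] at hp1 hp2
    have hz0 : (z : ℤ) ≠ 0 := by omega
    have hss : s = s' := mul_right_cancel₀ hz0 (by linarith)
    subst hss
    ext <;> omega

/-- The rounding term 1 in the fibre count is at most (Y / z) · gcd(z, b), as z ≤ Y. Absorbing it
produces the factor 1 + 2MY/Z. -/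
lemma card_coincidences_le {M X Y Z x₀ y₀ h i j : ℕ} (h4 : 4 ∣ M) (hM : 0 < M) (hX : 0 < X)
    (hZ : 0 < Z) (hy₀ : y₀.Coprime M) :
    ((coincidences M X Y Z x₀ y₀ h i j).card : ℝ) ≤
      (1 + 2 * M * Y / Z) * (Z / (2 * M * X)) * gapSum M Y y₀ (squareGap M h i j) := by
  have hMr : (0 : ℝ) < M := by exact_mod_cast hM
  have hXr : (0 : ℝ) < X := by exact_mod_cast hX
  have hZr : (0 : ℝ) < Z := by exact_mod_cast hZ
  have hM2 : 2 ∣ M := (by norm_num : (2 : ℕ) ∣ 4).trans h4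
  have h0 := card_coincidences_le_sum (X := X) (Y := Y) (Z := Z) (x₀ := x₀) (h := h) (i := i)
    (j := j) h4 hM hX hy₀
  have h0' : ((coincidences M X Y Z x₀ y₀ h i j).card : ℝ) ≤ _ := Nat.cast_le.2 h0
  refine h0'.trans ?_
  simp only [Nat.cast_sum]
  rw [gapSum, Finset.mul_sum]
  apply Finset.sum_le_sum
  intro z hz
  rw [Finset.mem_filter, Finset.mem_Icc] at hz
  obtain ⟨⟨hz1, hzY⟩, hzy⟩ := hz
  have hz0 : (0 : ℝ) < z := by exact_mod_cast hz1
  have hzYr : (z : ℝ) ≤ Y := by exact_mod_cast hzY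
  have hzM : z.Coprime M := by rw [Nat.Coprime, hzy.gcd_eq]; exact hy₀
  set e := squareGap M h i j with he
  set B := ⌊((z : ℝ) * ((min z (Y - z) : ℕ) : ℝ) / M + e) / X⌋₊ with hB
  have hBle : (B : ℝ) ≤ ((z : ℝ) * ((min z (Y - z) : ℕ) : ℝ) / M + e) / X :=
    Nat.floor_le (by positivity)
  have hfib : ∀ b ∈ Finset.Icc 1 B, ((fibre M X Z x₀ z b (signedGap M h i j)).card : ℝ) ≤
      (1 + 2 * M * Y / Z) * (Z / (2 * M * z)) * (if z.gcd b ∣ e then (z.gcd b : ℝ) else 0) := by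
    intro b _
    have := card_fibre_le (X := X) (Z := Z) (x₀ := x₀) (b := b) (E := signedGap M h i j)
      hM hM2 (by omega) hzM
    rw [natAbs_signedGap, ← he] at this
    refine this.trans ?_
    split_ifs with hd
    · have hg : (1 : ℝ) ≤ z.gcd b := by exact_mod_cast Nat.gcd_pos_of_pos_left b (by omega)
      have e1 : (1 + 2 * M * Y / Z) * (Z / (2 * M * z)) * (z.gcd b : ℝ)
          = (Z : ℝ) * z.gcd b / (2 * M * z) + Y / z * z.gcd b := by field_simp
      rw [e1]
      have : (1 : ℝ) ≤ Y / z := (one_le_div hz0).2 hzYr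
      linarith [one_le_mul_of_one_le_of_one_le this hg]
    · simp
  refine (Finset.sum_le_sum hfib).trans ?_
  rw [← Finset.mul_sum]
  have h1 := sum_gcd_le z e (by omega) B
  have h2 : (B : ℝ) * (z.divisors.filter (fun d => d ∣ e)).card ≤
      (((z : ℝ) * ((min z (Y - z) : ℕ) : ℝ) / M + e) / X)
        * (z.divisors.filter (fun d => d ∣ e)).card :=
    mul_le_mul_of_nonneg_right hBle (by positivity)
  have h3 := mul_le_mul_of_nonneg_left (h1.trans h2)
    (by positivity : (0 : ℝ) ≤ (1 + 2 * M * Y / Z) * (Z / (2 * M * z)))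
  refine h3.trans (le_of_eq ?_)
  field_simp

/-! ### The second moment -/

/-- Cauchy–Schwarz applied to the fibre sizes of φ, whose squares sum to the energy. -/
lemma card_sq_le_card_image_mul_energy {α : Type*} [DecidableEq α] (s : Finset α) (φ : α → ℕ) :
    s.card ^ 2 ≤ (s.image φ).card * ((s ×ˢ s).filter (fun p => φ p.1 = φ p.2)).card := by
  have h1 := Finset.card_eq_sum_card_image φ s
  have h2 : ((s ×ˢ s).filter (fun p => φ p.1 = φ p.2)).card
      = ∑ n ∈ s.image φ, (s.filter (fun a => φ a = n)).card ^ 2 := by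
    rw [Finset.card_eq_sum_card_fiberwise (f := fun p => φ p.1) (t := s.image φ)]
    · refine Finset.sum_congr rfl fun n _ => ?_
      rw [sq, ← Finset.card_product]
      congr 1
      ext ⟨a, b⟩
      simp only [Finset.mem_filter, Finset.mem_product]
      constructor
      · rintro ⟨⟨⟨ha, hb⟩, hab⟩, hn⟩
        exact ⟨⟨ha, hn⟩, hb, hab ▸ hn⟩
      · rintro ⟨⟨ha, hn⟩, hb, hn'⟩
        exact ⟨⟨⟨ha, hb⟩, hn.trans hn'.symm⟩, hn⟩
    · intro p hp
      simp only [Finset.coe_filter, Finset.mem_product, Set.mem_ofPred_eq] at hp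
      exact Finset.mem_coe.2 (Finset.mem_image_of_mem φ hp.1.1)
  rw [h2]
  nth_rw 1 [h1]
  exact sq_sum_le_card_mul_sum_sq

/-- The value `x² + y² + (h + 2 M i)²` of the ternary form at `((x, y), i)`. -/
def ternaryValue (M h : ℕ) (t : (ℕ × ℕ) × ℕ) : ℕ :=
  t.1.1 ^ 2 + t.1.2 ^ 2 + (h + 2 * M * t.2) ^ 2

/-- The triples `((x, y), i)` over which representations are counted. -/
def triples (M X Y Z x₀ y₀ J : ℕ) : Finset ((ℕ × ℕ) × ℕ) :=
  boxPairs M X Y Z x₀ y₀ ×ˢ Finset.range J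

/-- The number of pairs of triples at which the ternary form takes equal values. -/
def energy (M X Y Z x₀ y₀ h J : ℕ) : ℕ :=
  ((triples M X Y Z x₀ y₀ J ×ˢ triples M X Y Z x₀ y₀ J).filter
    (fun p => ternaryValue M h p.1 = ternaryValue M h p.2)).card

/-- Here (y − v)(y + v) is 4M times the signed gap, which is nonzero, so y + v is at most its
absolute value. -/
lemma le_of_sq_add_eq {M y v h i j : ℕ} (hh : 1 ≤ h) (hM : 0 < M) (hij : i ≠ j)
    (heq : y ^ 2 + (h + 2 * M * i) ^ 2 = v ^ 2 + (h + 2 * M * j) ^ 2) :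
    y ≤ 4 * M * squareGap M h i j := by
  have h1 : ((y : ℤ) - v) * (y + v) = 4 * M * signedGap M h i j := by
    have : (y : ℤ) ^ 2 + (h + 2 * M * i) ^ 2 = v ^ 2 + (h + 2 * M * j) ^ 2 := by exact_mod_cast heq
    unfold signedGap
    linear_combination this
  have h2 := congrArg Int.natAbs h1
  rw [Int.natAbs_mul, Int.natAbs_mul, natAbs_signedGap] at h2
  have e1 : (4 * (M : ℤ)).natAbs = 4 * M := by omega
  have e2 : ((y : ℤ) + v).natAbs = y + v := by omega
  rw [e1, e2] at h2
  have h3 : 0 < 4 * M * squareGap M h i j :=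
    Nat.mul_pos (by omega) (Nat.pos_of_ne_zero (squareGap_ne_zero hh hij))
  rw [← h2] at h3 ⊢
  have h4 : 1 ≤ ((y : ℤ) - v).natAbs := Nat.pos_of_mul_pos_right h3
  calc y ≤ 1 * (y + v) := by omega
    _ ≤ _ := Nat.mul_le_mul_right _ h4

/-- Compare x with u. The two strict cases are mirror images. When x = u, the data x, y, i, j
determine v; y is free up to Y if i = j, but at most 4MG if i ≠ j. -/
lemma energy_le {M X Y Z x₀ y₀ h J G : ℕ} (hh : 1 ≤ h) (hM : 0 < M)
    (hG : ∀ i < J, ∀ j < J, squareGap M h i j ≤ G) :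
    energy M X Y Z x₀ y₀ h J ≤
      2 * (∑ i ∈ Finset.range J, ∑ j ∈ Finset.range J, (coincidences M X Y Z x₀ y₀ h i j).card)
      + (J * (Z * Y) + J * (J * (Z * (4 * M * G)))) := by
  set T := triples M X Y Z x₀ y₀ J with hT
  set P := (T ×ˢ T).filter (fun p => ternaryValue M h p.1 = ternaryValue M h p.2) with hP
  have hmem : ∀ p ∈ P, (p.1.1 ∈ boxPairs M X Y Z x₀ y₀ ∧ p.1.2 < J) ∧
      (p.2.1 ∈ boxPairs M X Y Z x₀ y₀ ∧ p.2.2 < J) ∧ p.1.1.1 ^ 2 + p.1.1.2 ^ 2 +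
        (h + 2 * M * p.1.2) ^ 2 = p.2.1.1 ^ 2 + p.2.1.2 ^ 2 + (h + 2 * M * p.2.2) ^ 2 := by
    intro p hp
    simp only [hP, hT, triples, Finset.mem_filter, Finset.mem_product, Finset.mem_range,
      ternaryValue] at hp
    exact ⟨hp.1.1, hp.1.2, hp.2⟩
  let Q : Finset (Σ _ : ℕ × ℕ, (ℕ × ℕ) × (ℕ × ℕ)) :=
    (Finset.range J ×ˢ Finset.range J).sigma fun q => coincidences M X Y Z x₀ y₀ h q.1 q.2
  have hQ : Q.card = ∑ i ∈ Finset.range J, ∑ j ∈ Finset.range J,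
      (coincidences M X Y Z x₀ y₀ h i j).card := by
    simp only [Q, Finset.card_sigma]
    rw [Finset.sum_product]
  let R : Finset (Σ _ : ℕ × ℕ, ℕ × ℕ) :=
    (Finset.range J ×ˢ Finset.range J).sigma fun q =>
      Finset.Ioc X (X + Z) ×ˢ Finset.Icc 1 (if q.1 = q.2 then Y else 4 * M * G)
  have hR : R.card ≤ J * (Z * Y) + J * (J * (Z * (4 * M * G))) := by
    simp only [R, Finset.card_sigma, Finset.card_product, Nat.card_Ioc, Nat.card_Icc,
      add_tsub_cancel_left, add_tsub_cancel_right]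
    rw [Finset.sum_product]
    calc _ ≤ ∑ i ∈ Finset.range J, (∑ j ∈ Finset.range J, (if i = j then Z * Y else 0)
          + ∑ j ∈ Finset.range J, Z * (4 * M * G)) := by
          apply Finset.sum_le_sum
          intro i _
          rw [← Finset.sum_add_distrib]
          apply Finset.sum_le_sum
          intro j _
          split_ifs <;> simp
      _ ≤ ∑ i ∈ Finset.range J, (Z * Y + J * (Z * (4 * M * G))) := by
          apply Finset.sum_le_sum
          intro i hi
          rw [Finset.sum_ite_eq, if_pos hi, Finset.sum_const, Finset.card_range, smul_eq_mul]
      _ = _ := by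
          rw [Finset.sum_const, Finset.card_range, smul_eq_mul]; ring
  have hlt : (P.filter (fun p => p.2.1.1 < p.1.1.1)).card ≤ Q.card := by
    apply Finset.card_le_card_of_injOn (fun p => ⟨(p.1.2, p.2.2), (p.1.1, p.2.1)⟩)
    · intro p hp
      obtain ⟨hp, hlt⟩ := Finset.mem_filter.1 (Finset.mem_coe.1 hp)
      obtain ⟨h1, h2, h3⟩ := hmem p hp
      simp only [Q, Finset.mem_coe, Finset.mem_sigma, Finset.mem_product, Finset.mem_range,
        coincidences, Finset.mem_filter]
      exact ⟨⟨h1.2, h2.2⟩, ⟨h1.1, h2.1⟩, hlt, h3⟩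
    · rintro ⟨⟨a, i⟩, ⟨b, j⟩⟩ _ ⟨⟨a', i'⟩, ⟨b', j'⟩⟩ _ hpq
      simp only [Sigma.mk.injEq, heq_eq_eq, Prod.mk.injEq] at hpq ⊢
      tauto
  have hgt : (P.filter (fun p => p.1.1.1 < p.2.1.1)).card ≤ Q.card := by
    apply Finset.card_le_card_of_injOn (fun p => ⟨(p.2.2, p.1.2), (p.2.1, p.1.1)⟩)
    · intro p hp
      obtain ⟨hp, hlt⟩ := Finset.mem_filter.1 (Finset.mem_coe.1 hp)
      obtain ⟨h1, h2, h3⟩ := hmem p hp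
      simp only [Q, Finset.mem_coe, Finset.mem_sigma, Finset.mem_product, Finset.mem_range,
        coincidences, Finset.mem_filter]
      exact ⟨⟨h2.2, h1.2⟩, ⟨h2.1, h1.1⟩, hlt, h3.symm⟩
    · rintro ⟨⟨a, i⟩, ⟨b, j⟩⟩ _ ⟨⟨a', i'⟩, ⟨b', j'⟩⟩ _ hpq
      simp only [Sigma.mk.injEq, heq_eq_eq, Prod.mk.injEq] at hpq ⊢
      tauto
  have heq : (P.filter (fun p => p.1.1.1 = p.2.1.1)).card ≤ R.card := by
    apply Finset.card_le_card_of_injOn (fun p => ⟨(p.1.2, p.2.2), p.1.1⟩)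
    · intro p hp
      obtain ⟨hp, he⟩ := Finset.mem_filter.1 (Finset.mem_coe.1 hp)
      obtain ⟨⟨h1, hi⟩, ⟨h2, hj⟩, h3⟩ := hmem p hp
      rw [mem_boxPairs] at h1 h2
      simp only [R, Finset.mem_coe, Finset.mem_sigma, Finset.mem_product, Finset.mem_range,
        Finset.mem_Ioc, Finset.mem_Icc]
      refine ⟨⟨hi, hj⟩, h1.1.1, h1.2.1.1, ?_⟩
      split_ifs with hij
      · exact h1.2.1.2
      · rw [he, add_assoc, add_assoc] at h3
        exact (le_of_sq_add_eq hh hM hij (Nat.add_left_cancel h3)).trans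
          (Nat.mul_le_mul_left _ (hG _ hi _ hj))
    · intro p hp q hq hpq
      obtain ⟨hp, he⟩ := Finset.mem_filter.1 (Finset.mem_coe.1 hp)
      obtain ⟨hq, he'⟩ := Finset.mem_filter.1 (Finset.mem_coe.1 hq)
      obtain ⟨-, -, h3⟩ := hmem p hp
      obtain ⟨-, -, h3'⟩ := hmem q hq
      obtain ⟨⟨⟨x, y⟩, i⟩, ⟨⟨u, v⟩, j⟩⟩ := p
      obtain ⟨⟨⟨x', y'⟩, i'⟩, ⟨⟨u', v'⟩, j'⟩⟩ := q
      simp only [Sigma.mk.injEq, heq_eq_eq, Prod.mk.injEq] at hpq he he' h3 h3'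
      obtain ⟨⟨rfl, rfl⟩, rfl, rfl⟩ := hpq
      subst he he'
      have : v ^ 2 = v' ^ 2 := by omega
      have := Nat.pow_left_injective (n := 2) (by norm_num) this
      subst this
      rfl
  have hsplit : P.card ≤ (P.filter (fun p => p.2.1.1 < p.1.1.1)).card
      + (P.filter (fun p => p.1.1.1 < p.2.1.1)).card
      + (P.filter (fun p => p.1.1.1 = p.2.1.1)).card := by
    refine (Finset.card_le_card ?_).trans ((Finset.card_union_le _ _).trans
      (Nat.add_le_add_right (Finset.card_union_le _ _) _))
    intro p hp
    simp only [Finset.mem_union, Finset.mem_filter]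
    rcases lt_trichotomy p.1.1.1 p.2.1.1 with h | h | h
    · exact Or.inl (Or.inr ⟨hp, h⟩)
    · exact Or.inr ⟨hp, h⟩
    · exact Or.inl (Or.inl ⟨hp, h⟩)
  rw [← hQ]
  change P.card ≤ _
  omega

lemma squareGap_le {M h J : ℕ} (hhM : h ≤ 2 * M) {i j : ℕ} (hi : i < J) (hj : j < J) :
    squareGap M h i j ≤ 4 * M * J ^ 2 := by
  unfold squareGap
  have h1 : (j - i) + (i - j) ≤ J := by omega
  have h2 : h + M * (i + j) ≤ 4 * M * J := by
    have : M * (i + j) ≤ M * (2 * J) := Nat.mul_le_mul_left M (by omega)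
    have : M * 1 ≤ M * J := Nat.mul_le_mul_left M (by omega)
    nlinarith
  calc _ ≤ J * (4 * M * J) := Nat.mul_le_mul h1 h2
    _ = _ := by ring

lemma sum_gapSum_le {M Y w y₀ h : ℕ} (J : ℕ) (hM : 0 < M) (hM2 : 2 ∣ M) (hY : 0 < Y) (hw : 1 ≤ w)
    (hJ : 0 < J) (hwM : ∀ d : ℕ, 1 < d → d.Coprime M → w < d) (hh : 1 ≤ h) (hhM : h ≤ 2 * M)
    (hy : y₀.Coprime M) {A : ℝ} (hA : A = J / w + 1 + Real.log (5 * M * J : ℕ)) :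
    ∑ i ∈ Finset.range J, ∑ j ∈ Finset.range J, gapSum M Y y₀ (squareGap M h i j) ≤
      J * ((Y : ℝ) ^ 2 * (1 + Real.log Y))
        + J ^ 2 * ((Y : ℝ) ^ 2 / (4 * M ^ 2) + 16 * M * Y * J ^ 2)
        + (Y : ℝ) ^ 2 / M ^ 2 * (2 * (A * (2 * J + A))) := by
  have hMJ : M * 1 ≤ M * J := Nat.mul_le_mul_left M hJ
  -- The bound 5MJ works because h ≤ 2M and J ≥ 1 give h + 3MJ ≤ 5MJ.
  have hF := sum_coprimeDivSum_squareGap_le (M := M) (h := h) J (5 * M * J) hw hM2 hwM hh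
    (by nlinarith) (by nlinarith)
  rw [← hA] at hF
  set K : ℝ := (Y : ℝ) ^ 2 / (4 * M ^ 2) + 16 * M * Y * J ^ 2 with hK
  have hK0 : 0 ≤ K := by positivity
  have hrow : ∀ i ∈ Finset.range J, ∑ j ∈ Finset.range J, gapSum M Y y₀ (squareGap M h i j) ≤
      (Y : ℝ) ^ 2 * (1 + Real.log Y) + J * K + (Y : ℝ) ^ 2 / M ^ 2 *
        ∑ j ∈ (Finset.range J).erase i, (coprimeDivSum M (squareGap M h i j) - 1) := by
    intro i hi
    rw [← Finset.add_sum_erase _ _ hi, add_assoc]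
    apply add_le_add
    · have : squareGap M h i i = 0 := by simp [squareGap]
      rw [this]
      exact gapSum_zero_le M Y y₀ hM
    · rw [Finset.mul_sum]
      calc _ ≤ ∑ j ∈ (Finset.range J).erase i,
            (K + (Y : ℝ) ^ 2 / M ^ 2 * (coprimeDivSum M (squareGap M h i j) - 1)) := by
            apply Finset.sum_le_sum
            intro j hj
            rw [Finset.mem_erase] at hj
            have h1 := gapSum_le hM hY (squareGap_ne_zero (M := M) hh (Ne.symm hj.1)) hy
            have h2 : (squareGap M h i j : ℝ) ≤ 4 * M * J ^ 2 := by
              exact_mod_cast squareGap_le hhM (Finset.mem_range.1 hi) (Finset.mem_range.1 hj.2)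
            have h3 : 4 * (Y : ℝ) * squareGap M h i j ≤ 4 * Y * (4 * M * J ^ 2) := by gcongr
            rw [hK]
            linarith
        _ ≤ _ := by
            rw [Finset.sum_add_distrib, Finset.sum_const, nsmul_eq_mul]
            have : (((Finset.range J).erase i).card : ℝ) ≤ J := by
              exact_mod_cast (Finset.card_erase_le).trans (by simp)
            have := mul_le_mul_of_nonneg_right this hK0
            linarith
  refine (Finset.sum_le_sum hrow).trans ?_
  rw [Finset.sum_add_distrib, ← Finset.mul_sum, Finset.sum_const, Finset.card_range, nsmul_eq_mul]
  have := mul_le_mul_of_nonneg_left hF (by positivity : (0 : ℝ) ≤ (Y : ℝ) ^ 2 / M ^ 2)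
  linarith

/-- The ratio of the energy to its expected size `Z Y² J² / (4 M³ X)` is at most this quantity. -/
noncomputable def energyRatio (M w X Y Z J : ℕ) : ℝ :=
  (1 + 2 * M * Y / Z) * (1 + 4 * M ^ 2 * (1 + Real.log Y) / J + 64 * M ^ 3 * J ^ 2 / Y
      + 8 * ((1 / w + (1 + Real.log (5 * M * J : ℕ)) / J)
          * (2 + (1 / w + (1 + Real.log (5 * M * J : ℕ)) / J))))
    + (4 * M ^ 3 * (X / (Y * J)) + 64 * M ^ 5 * (X * J ^ 2 / Y ^ 2))

/-- In the ratio, the term with log Y comes from i = j, the term with 1/w from common divisors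
exceeding w, and the last two from x = u with i = j and with i ≠ j. -/
lemma energy_le_energyRatio {M X Y Z w x₀ y₀ h J : ℕ} (h4 : 4 ∣ M) (hM : 0 < M) (hX : 0 < X)
    (hY : 0 < Y) (hZ : 0 < Z) (hJ : 0 < J) (hw : 1 ≤ w)
    (hwM : ∀ d : ℕ, 1 < d → d.Coprime M → w < d) (hh : 1 ≤ h) (hhM : h ≤ 2 * M)
    (hy : y₀.Coprime M) :
    (energy M X Y Z x₀ y₀ h J : ℝ) ≤
      (Z * Y ^ 2 * J ^ 2 / (4 * M ^ 3 * X)) * energyRatio M w X Y Z J := by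
  have hM2 : 2 ∣ M := (by norm_num : (2 : ℕ) ∣ 4).trans h4
  have hMr : (0 : ℝ) < M := by exact_mod_cast hM
  have hXr : (0 : ℝ) < X := by exact_mod_cast hX
  have hYr : (0 : ℝ) < Y := by exact_mod_cast hY
  have hZr : (0 : ℝ) < Z := by exact_mod_cast hZ
  have hJr : (0 : ℝ) < J := by exact_mod_cast hJ
  have hwr : (0 : ℝ) < w := by exact_mod_cast hw
  have h1 := energy_le (X := X) (Y := Y) (Z := Z) (x₀ := x₀) (y₀ := y₀) (J := J) hh hM
    (fun i hi j hj => squareGap_le hhM hi hj)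
  have h1' : (energy M X Y Z x₀ y₀ h J : ℝ) ≤ 2 * (∑ i ∈ Finset.range J, ∑ j ∈ Finset.range J,
      ((coincidences M X Y Z x₀ y₀ h i j).card : ℝ))
      + (J * (Z * Y) + J * (J * (Z * (4 * M * (4 * M * J ^ 2))))) := by exact_mod_cast h1
  have h2 : ∑ i ∈ Finset.range J, ∑ j ∈ Finset.range J,
      ((coincidences M X Y Z x₀ y₀ h i j).card : ℝ) ≤
      (1 + 2 * M * Y / Z) * (Z / (2 * M * X)) *
        ∑ i ∈ Finset.range J, ∑ j ∈ Finset.range J, gapSum M Y y₀ (squareGap M h i j) := by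
    rw [Finset.mul_sum]
    apply Finset.sum_le_sum
    intro i _
    rw [Finset.mul_sum]
    exact Finset.sum_le_sum fun j _ => card_coincidences_le h4 hM hX hZ hy
  have h3 := sum_gapSum_le (Y := Y) (y₀ := y₀) J hM hM2 hY hw hJ hwM hh hhM hy rfl
  set lR := Real.log (5 * M * J : ℕ) with hlR
  set lY := Real.log Y with hlY
  have h5 := mul_le_mul_of_nonneg_left h3
    (by positivity : (0 : ℝ) ≤ (1 + 2 * M * Y / Z) * (Z / (2 * M * X)))
  refine h1'.trans ((add_le_add_left (mul_le_mul_of_nonneg_left (h2.trans h5)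
    (by norm_num : (0 : ℝ) ≤ 2)) _).trans (le_of_eq ?_))
  unfold energyRatio
  rw [← hlR, ← hlY]
  refine (congrArg₂ (· + ·) ?_ ?_).trans (mul_add _ _ _).symm
  · have : ∀ κ : ℝ, 2 * (κ * (Z / (2 * M * X)) *
        (J * ((Y : ℝ) ^ 2 * (1 + lY)) + J ^ 2 * ((Y : ℝ) ^ 2 / (4 * M ^ 2) + 16 * M * Y * J ^ 2)
          + (Y : ℝ) ^ 2 / M ^ 2 * (2 * ((J / w + 1 + lR) * (2 * J + (J / w + 1 + lR)))))) =
        Z * Y ^ 2 * J ^ 2 / (4 * M ^ 3 * X) * (κ * (1 + 4 * M ^ 2 * (1 + lY) / J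
          + 64 * M ^ 3 * J ^ 2 / Y
          + 8 * ((1 / w + (1 + lR) / J) * (2 + (1 / w + (1 + lR) / J))))) := by
      intro κ
      field_simp
      ring
    exact this _
  · field_simp
    ring

/-! ### Integers represented in a block and a residue class -/

/-- The proportion of integers of a block that may fail to be represented. -/
noncomputable def defect (M w X Y Z J : ℕ) : ℝ :=
  1 + Z / (2 * X) - ((1 - 2 * M / Z) * (1 - M / Y)) ^ 2 / energyRatio M w X Y Z J
    + M * (1 / (X * Z) + Y ^ 2 / (X * Z) + 4 * M ^ 2 * (J ^ 2 / (X * Z)))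

lemma le_card_triples {M X Y Z x₀ y₀ J : ℕ} (hM : 0 < M) (hY : M ≤ Y) (hZ : 2 * M ≤ Z) :
    (Z * Y * J / (2 * M ^ 2) : ℝ) * ((1 - 2 * M / Z) * (1 - M / Y)) ≤
      (triples M X Y Z x₀ y₀ J).card := by
  have hMr : (0 : ℝ) < M := by exact_mod_cast hM
  have hYr : (M : ℝ) ≤ Y := by exact_mod_cast hY
  have hZr : (2 * M : ℝ) ≤ Z := by exact_mod_cast hZ
  have h1 := le_card_Ioc_modEq X Z (2 * M) x₀ (by omega)
  have h2 := le_card_Ioc_modEq 0 Y M y₀ hM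
  rw [zero_add] at h2
  push_cast at h1
  have h3 : (0 : ℝ) ≤ Y / M - 1 := by rw [sub_nonneg, one_le_div hMr]; exact hYr
  rw [triples, boxPairs, Finset.card_product, Finset.card_product, Finset.card_range]
  push_cast
  have h4 := mul_le_mul h1 h2 h3 (Nat.cast_nonneg _)
  have h5 := mul_le_mul_of_nonneg_right h4 (Nat.cast_nonneg (α := ℝ) J)
  refine le_trans (le_of_eq ?_) h5
  have : (0 : ℝ) < Y := by linarith
  have : (0 : ℝ) < Z := by linarith
  field_simp

open Classical in
-- Unrepresented members of the class are disjoint from the image, which Cauchy–Schwarz bounds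
-- below. Image values may overshoot the block, by at most Y² + (2MJ)², and these are charged to the
-- extra interval `V`.
lemma card_unrepresented_le {M X Y Z w x₀ y₀ h J a : ℕ} (h4 : 4 ∣ M) (hM : 0 < M) (hX : 0 < X)
    (hY : M ≤ Y) (hZ : 2 * M ≤ Z) (hJ : 0 < J) (hw : 1 ≤ w)
    (hwM : ∀ d : ℕ, 1 < d → d.Coprime M → w < d) (hh : 1 ≤ h) (hhM : h ≤ 2 * M)
    (hy : y₀.Coprime M) (ha : x₀ ^ 2 + y₀ ^ 2 + h ^ 2 ≡ a [MOD 2 * M]) :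
    (((Finset.Ioc (X ^ 2) ((X + Z) ^ 2)).filter
      (fun n => n ≡ a [MOD 2 * M] ∧ ¬ HasMicrosquareRep n (2 * M * J : ℕ))).card : ℝ)
      ≤ X * Z / M * defect M w X Y Z J := by
  have hMr : (0 : ℝ) < M := by exact_mod_cast hM
  have hXr : (0 : ℝ) < X := by exact_mod_cast hX
  have hYr : (0 : ℝ) < Y := by exact_mod_cast hM.trans_le hY
  have hZr : (0 : ℝ) < Z := by exact_mod_cast (by omega : 0 < Z)
  have hJr : (0 : ℝ) < J := by exact_mod_cast hJ
  set T := triples M X Y Z x₀ y₀ J with hT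
  set I := T.image (ternaryValue M h) with hI
  have hcs := card_sq_le_card_image_mul_energy T (ternaryValue M h)
  have hen := energy_le_energyRatio (X := X) (Z := Z) (x₀ := x₀) h4 hM hX (hM.trans_le hY)
    (by omega) hJ hw hwM hh hhM hy
  have hcs' : (T.card : ℝ) ^ 2 ≤ I.card * energy M X Y Z x₀ y₀ h J := by exact_mod_cast hcs
  have hER : 0 < energyRatio M w X Y Z J := by
    unfold energyRatio
    have h1 := Real.log_natCast_nonneg Y
    have h2 := Real.log_natCast_nonneg (5 * M * J)
    positivity
  have hIle : (X * Z / M : ℝ) * (((1 - 2 * M / Z) * (1 - M / Y)) ^ 2 / energyRatio M w X Y Z J)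
      ≤ I.card := by
    rw [← mul_div_assoc, div_le_iff₀ hER]
    have h1 : (0 : ℝ) ≤ (Z * Y * J / (2 * M ^ 2) : ℝ) * ((1 - 2 * M / Z) * (1 - M / Y)) := by
      have h1 : (0 : ℝ) ≤ 1 - 2 * M / Z := by
        rw [sub_nonneg, div_le_one hZr]; exact_mod_cast hZ
      have h2 : (0 : ℝ) ≤ 1 - M / Y := by
        rw [sub_nonneg, div_le_one hYr]; exact_mod_cast hY
      positivity
    have h2 := pow_le_pow_left₀ h1 (le_card_triples (X := X) (x₀ := x₀) (y₀ := y₀) (J := J)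
      hM hY hZ) 2
    have h3 := (h2.trans hcs').trans
      (mul_le_mul_of_nonneg_left hen (Nat.cast_nonneg I.card))
    have hpos : (0 : ℝ) < Z * Y ^ 2 * J ^ 2 / (4 * M ^ 3 * X) := by positivity
    refine le_of_mul_le_mul_left ?_ hpos
    refine le_trans (le_of_eq ?_) (h3.trans (le_of_eq ?_))
    · generalize (1 - 2 * (M : ℝ) / Z) * (1 - M / Y) = ρ
      field_simp
      ring
    · ring
  have hImem : ∀ n ∈ I, X ^ 2 < n ∧ n ≤ (X + Z) ^ 2 + (Y ^ 2 + (2 * M * J) ^ 2) ∧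
      n ≡ a [MOD 2 * M] ∧ HasMicrosquareRep n (2 * M * J : ℕ) := by
    intro n hn
    obtain ⟨⟨⟨x, y⟩, i⟩, ht, rfl⟩ := Finset.mem_image.1 hn
    simp only [hT, triples, Finset.mem_product, mem_boxPairs, Finset.mem_range] at ht
    obtain ⟨⟨⟨⟨hx1, hx2⟩, hx⟩, ⟨hy1, hy2⟩, hy'⟩, hi⟩ := ht
    have hhi : h + 2 * M * i ≤ 2 * M * J := by
      have := Nat.mul_le_mul_left (2 * M) (Nat.succ_le_of_lt hi)
      rw [Nat.succ_eq_add_one, mul_add] at this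
      omega
    simp only [ternaryValue]
    refine ⟨?_, ?_, ?_, x, y, h + 2 * M * i, by omega, hy1, by omega, rfl, by exact_mod_cast hhi⟩
    · have := Nat.pow_lt_pow_left hx1 (n := 2) (by norm_num)
      omega
    · have h1 := Nat.pow_le_pow_left hx2 2
      have h2 := Nat.pow_le_pow_left hy2 2
      have h3 := Nat.pow_le_pow_left hhi 2
      omega
    · refine Nat.ModEq.trans ?_ ha
      refine Nat.ModEq.add (Nat.ModEq.add (hx.pow 2) ?_) (Nat.ModEq.pow 2 ?_)
      -- Although y is fixed only modulo M, its square is fixed modulo 2M because M is even.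
      · obtain ⟨c, hc⟩ := (Nat.modEq_iff_dvd).1 hy'
        obtain ⟨m, rfl⟩ := h4
        rw [Nat.modEq_iff_dvd]
        refine ⟨c * (y + 2 * m * c), ?_⟩
        have : (y₀ : ℤ) = y + (4 * m : ℕ) * c := by linarith
        push_cast at this ⊢
        rw [this]; ring
      · rw [Nat.ModEq, Nat.add_mul_mod_self_left]
  set C := (Finset.Ioc (X ^ 2) ((X + Z) ^ 2)).filter (fun n => n ≡ a [MOD 2 * M]) with hC
  set U := (Finset.Ioc (X ^ 2) ((X + Z) ^ 2)).filter
      (fun n => n ≡ a [MOD 2 * M] ∧ ¬ HasMicrosquareRep n (2 * M * J : ℕ)) with hU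
  set V := Finset.Ioc ((X + Z) ^ 2) ((X + Z) ^ 2 + (Y ^ 2 + (2 * M * J) ^ 2)) with hV
  have hdisj : Disjoint U I := by
    rw [Finset.disjoint_left]
    intro n hn hn'
    exact (Finset.mem_filter.1 hn).2.2 (hImem n hn').2.2.2
  have hcard : U.card + I.card ≤ C.card + V.card := by
    rw [← Finset.card_union_of_disjoint hdisj]
    refine (Finset.card_le_card ?_).trans (Finset.card_union_le _ _)
    intro n hn
    rw [Finset.mem_union] at hn ⊢
    rcases hn with hn | hn
    · simp only [hU, Finset.mem_filter] at hn
      exact Or.inl (Finset.mem_filter.2 ⟨hn.1, hn.2.1⟩)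
    · obtain ⟨h1, h2, h3, -⟩ := hImem n hn
      by_cases hle : n ≤ (X + Z) ^ 2
      · exact Or.inl (Finset.mem_filter.2 ⟨Finset.mem_Ioc.2 ⟨h1, hle⟩, h3⟩)
      · exact Or.inr (Finset.mem_Ioc.2 ⟨by omega, h2⟩)
  have hCcard : (C.card : ℝ) ≤ (2 * X * Z + Z ^ 2) / (2 * M) + 1 := by
    have := card_Ioc_modEq_le (X ^ 2) (2 * X * Z + Z ^ 2) (2 * M) a (by omega)
    have e : X ^ 2 + (2 * X * Z + Z ^ 2) = (X + Z) ^ 2 := by ring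
    rw [e] at this
    push_cast at this
    exact this
  have hVcard : V.card = Y ^ 2 + (2 * M * J) ^ 2 := by simp [hV]
  have hcard' : (U.card : ℝ) + I.card ≤ C.card + (Y ^ 2 + (2 * M * J) ^ 2) := by
    rw [hVcard] at hcard
    exact_mod_cast hcard
  have e : (X * Z / M : ℝ) * defect M w X Y Z J = (2 * X * Z + Z ^ 2) / (2 * M) + 1
      + (Y ^ 2 + (2 * M * J) ^ 2) - (X * Z / M : ℝ) *
        (((1 - 2 * M / Z) * (1 - M / Y)) ^ 2 / energyRatio M w X Y Z J) := by
    unfold defect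
    generalize ((1 - 2 * (M : ℝ) / Z) * (1 - M / Y)) ^ 2 / energyRatio M w X Y Z J = ρ
    field_simp
    ring
  rw [e]
  linarith

/-! ### Choice of parameters -/

/-- The range of the middle variable. -/
noncomputable def rangeY (X : ℕ) : ℕ := ⌊(X : ℝ) / Real.log X⌋₊

/-- The number of small squares. -/
noncomputable def rangeJ (X : ℕ) : ℕ := ⌊Real.log X * Real.log (Real.log X)⌋₊

lemma tendsto_log_natCast : Tendsto (fun X : ℕ => Real.log X) atTop atTop :=
  Real.tendsto_log_atTop.comp tendsto_natCast_atTop_atTop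

lemma tendsto_log_log_natCast : Tendsto (fun X : ℕ => Real.log (Real.log X)) atTop atTop :=
  Real.tendsto_log_atTop.comp tendsto_log_natCast

lemma tendsto_log_pow_div (n : ℕ) :
    Tendsto (fun X : ℕ => Real.log X ^ n / (X : ℝ)) atTop (𝓝 0) := by
  have := (Real.tendsto_pow_log_div_mul_add_atTop 1 0 n one_ne_zero).comp
    (tendsto_natCast_atTop_atTop (R := ℝ))
  simpa [Function.comp_def] using this

lemma tendsto_log_div_self : Tendsto (fun x : ℝ => Real.log x / x) atTop (𝓝 0) := by
  simpa using Real.tendsto_pow_log_div_mul_add_atTop 1 0 1 one_ne_zero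

lemma tendsto_div_log : Tendsto (fun X : ℕ => (X : ℝ) / Real.log X) atTop atTop := by
  have h1 : Tendsto (fun X : ℕ => Real.log X ^ 1 / (X : ℝ)) atTop (𝓝[>] 0) := by
    refine tendsto_nhdsWithin_iff.2 ⟨tendsto_log_pow_div 1, ?_⟩
    filter_upwards [eventually_gt_atTop 1] with X hX
    have : 0 < Real.log X := Real.log_pos (by exact_mod_cast hX)
    have : (0 : ℝ) < X := by positivity
    exact Set.mem_Ioi.2 (by positivity)
  refine h1.inv_tendsto_nhdsGT_zero.congr fun X => ?_
  simp

/-- Floors are handled only here and in `tendsto_rangeJ_ratio`; many of the limits below factor into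
these ratios and elementary limits in log X. -/
lemma tendsto_rangeY_ratio :
    Tendsto (fun X : ℕ => (rangeY X : ℝ) / (X / Real.log X)) atTop (𝓝 1) :=
  (tendsto_nat_floor_div_atTop (R := ℝ)).comp tendsto_div_log

lemma tendsto_rangeJ_ratio :
    Tendsto (fun X : ℕ => (rangeJ X : ℝ) / (Real.log X * Real.log (Real.log X))) atTop (𝓝 1) :=
  (tendsto_nat_floor_div_atTop (R := ℝ)).comp
    (tendsto_log_natCast.atTop_mul_atTop₀ tendsto_log_log_natCast)

lemma tendsto_rangeY : Tendsto rangeY atTop atTop :=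
  tendsto_nat_floor_atTop.comp tendsto_div_log

lemma tendsto_rangeJ : Tendsto rangeJ atTop atTop :=
  tendsto_nat_floor_atTop.comp (tendsto_log_natCast.atTop_mul_atTop₀ tendsto_log_log_natCast)

lemma tendsto_div_nat {k : ℕ} (hk : 0 < k) : Tendsto (fun X : ℕ => X / k) atTop atTop :=
  Nat.tendsto_div_const_atTop hk.ne'

lemma tendsto_div_nat_ratio {k : ℕ} (hk : 0 < k) :
    Tendsto (fun X : ℕ => ((X / k : ℕ) : ℝ) / X) atTop (𝓝 (1 / k)) := by
  have hkr : (0 : ℝ) < k := by exact_mod_cast hk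
  have h1 : Tendsto (fun X : ℕ => (X : ℝ) / k) atTop atTop :=
    tendsto_natCast_atTop_atTop.atTop_div_const hkr
  have h2 := ((tendsto_nat_floor_div_atTop (R := ℝ)).comp h1).mul_const (1 / (k : ℝ))
  rw [one_mul] at h2
  refine h2.congr' ?_
  filter_upwards [eventually_gt_atTop 0] with X hX
  have : (0 : ℝ) < X := by exact_mod_cast hX
  simp only [Function.comp_apply, Nat.floor_div_eq_div]
  field_simp

lemma eventually_parameters_pos : ∀ᶠ X : ℕ in atTop, (0 : ℝ) < X ∧ 0 < Real.log X ∧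
    0 < Real.log (Real.log X) ∧ (0 : ℝ) < rangeY X ∧ (0 : ℝ) < rangeJ X := by
  filter_upwards [eventually_gt_atTop 0, tendsto_log_natCast.eventually_gt_atTop 0,
    tendsto_log_log_natCast.eventually_gt_atTop 0, tendsto_rangeY.eventually_gt_atTop 0,
    tendsto_rangeJ.eventually_gt_atTop 0] with X h1 h2 h3 h4 h5
  exact ⟨by exact_mod_cast h1, h2, h3, by exact_mod_cast h4, by exact_mod_cast h5⟩

lemma tendsto_log_log_div_log :
    Tendsto (fun X : ℕ => Real.log (Real.log X) / Real.log X) atTop (𝓝 0) :=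
  tendsto_log_div_self.comp tendsto_log_natCast

lemma tendsto_rangeY_div_self : Tendsto (fun X : ℕ => (rangeY X : ℝ) / X) atTop (𝓝 0) := by
  have h := tendsto_rangeY_ratio.mul tendsto_log_natCast.inv_tendsto_atTop
  rw [mul_zero] at h
  refine h.congr' ?_
  filter_upwards [eventually_parameters_pos] with X ⟨h1, h2, _, _, _⟩
  simp only [Pi.inv_apply]
  field_simp

lemma tendsto_rangeJ_sq_div_rangeY :
    Tendsto (fun X : ℕ => (rangeJ X : ℝ) ^ 2 / rangeY X) atTop (𝓝 0) := by
  have h := ((tendsto_rangeJ_ratio.pow 2).mul (tendsto_rangeY_ratio.inv₀ one_ne_zero)).mul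
    ((tendsto_log_log_div_log.pow 2).mul (tendsto_log_pow_div 5))
  norm_num at h
  refine h.congr' ?_
  filter_upwards [eventually_parameters_pos] with X ⟨h1, h2, h3, h4, _⟩
  field_simp

lemma tendsto_self_mul_rangeJ_sq_div :
    Tendsto (fun X : ℕ => (X : ℝ) * rangeJ X ^ 2 / rangeY X ^ 2) atTop (𝓝 0) := by
  have h := ((tendsto_rangeJ_ratio.pow 2).mul ((tendsto_rangeY_ratio.inv₀ one_ne_zero).pow 2)).mul
    ((tendsto_log_log_div_log.pow 2).mul (tendsto_log_pow_div 6))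
  norm_num at h
  refine h.congr' ?_
  filter_upwards [eventually_parameters_pos] with X ⟨h1, h2, h3, h4, _⟩
  field_simp

/-- The quantity is asymptotic to 1 / log log X, so the log log factor in J is what makes it vanish.
-/
lemma tendsto_self_div_mul :
    Tendsto (fun X : ℕ => (X : ℝ) / (rangeY X * rangeJ X)) atTop (𝓝 0) := by
  have h := ((tendsto_rangeJ_ratio.inv₀ one_ne_zero).mul
    (tendsto_rangeY_ratio.inv₀ one_ne_zero)).mul tendsto_log_log_natCast.inv_tendsto_atTop
  rw [mul_zero] at h
  refine h.congr' ?_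
  filter_upwards [eventually_parameters_pos] with X ⟨h1, h2, h3, h4, h5⟩
  simp only [Pi.inv_apply]
  field_simp

lemma tendsto_log_div_rangeJ :
    Tendsto (fun X : ℕ => Real.log X / rangeJ X) atTop (𝓝 0) := by
  have h := (tendsto_rangeJ_ratio.inv₀ one_ne_zero).mul tendsto_log_log_natCast.inv_tendsto_atTop
  rw [mul_zero] at h
  refine h.congr' ?_
  filter_upwards [eventually_parameters_pos] with X ⟨h1, h2, h3, h4, h5⟩
  simp only [Pi.inv_apply]
  field_simp

lemma tendsto_natCast_inv {f : ℕ → ℕ} (hf : Tendsto f atTop atTop) :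
    Tendsto (fun X => (1 : ℝ) / f X) atTop (𝓝 0) :=
  tendsto_one_div_atTop_nhds_zero_nat.comp hf

lemma tendsto_one_add_log_rangeY_div :
    Tendsto (fun X : ℕ => (1 + Real.log (rangeY X)) / rangeJ X) atTop (𝓝 0) := by
  have h := (tendsto_natCast_inv tendsto_rangeJ).add tendsto_log_div_rangeJ
  rw [add_zero] at h
  refine squeeze_zero' (Eventually.of_forall fun X => ?_) ?_ h
  · have := Real.log_natCast_nonneg (rangeY X)
    positivity
  · filter_upwards [eventually_parameters_pos, tendsto_log_natCast.eventually_ge_atTop 1]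
      with X ⟨h1, h2, h3, h4, h5⟩ h6
    rw [← add_div]
    gcongr
    have h7 : (0 : ℝ) ≤ (X : ℝ) / Real.log X := by positivity
    have h8 : (rangeY X : ℝ) ≤ X := (Nat.floor_le h7).trans (div_le_self h1.le h6)
    exact_mod_cast h8

lemma tendsto_one_add_log_rangeJ_div {c : ℕ} (hc : 0 < c) :
    Tendsto (fun X : ℕ => (1 + Real.log (c * rangeJ X : ℕ)) / rangeJ X) atTop (𝓝 0) := by
  have h1 : Tendsto (fun X : ℕ => Real.log (rangeJ X) / rangeJ X) atTop (𝓝 0) :=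
    tendsto_log_div_self.comp (tendsto_natCast_atTop_atTop.comp tendsto_rangeJ)
  have h := ((tendsto_natCast_inv tendsto_rangeJ).const_mul (1 + Real.log c)).add h1
  rw [mul_zero, add_zero] at h
  refine h.congr' ?_
  filter_upwards [eventually_parameters_pos] with X ⟨_, _, _, _, h5⟩
  have hcr : (c : ℝ) ≠ 0 := by exact_mod_cast hc.ne'
  push_cast
  rw [Real.log_mul hcr h5.ne']
  ring

lemma tendsto_rangeY_div_div {k : ℕ} (hk : 0 < k) :
    Tendsto (fun X : ℕ => (rangeY X : ℝ) / (X / k : ℕ)) atTop (𝓝 0) := by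
  have hkr : (1 / k : ℝ) ≠ 0 := by positivity
  have h := tendsto_rangeY_div_self.div (tendsto_div_nat_ratio hk) hkr
  rw [zero_div] at h
  refine h.congr' ?_
  filter_upwards [eventually_parameters_pos] with X ⟨h1, _⟩
  simp only [Pi.div_apply]
  rw [div_div_div_cancel_right₀ h1.ne']

/-- With M and w fixed, only the main term 1 and the contribution of common divisors exceeding w
survive. -/
lemma tendsto_energyRatio {M k : ℕ} (w : ℕ) (hM : 0 < M) (hk : 0 < k) :
    Tendsto (fun X : ℕ => energyRatio M w X (rangeY X) (X / k) (rangeJ X)) atTop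
      (𝓝 (1 + 8 * (1 / w * (2 + 1 / w)))) := by
  have hl : Tendsto (fun X : ℕ => 1 / (w : ℝ) + (1 + Real.log (5 * M * rangeJ X : ℕ)) / rangeJ X)
      atTop (𝓝 (1 / w + 0)) :=
    tendsto_const_nhds.add (tendsto_one_add_log_rangeJ_div (c := 5 * M) (by omega))
  have h := (((tendsto_rangeY_div_div hk).const_mul (2 * (M : ℝ))).const_add 1).mul
    ((((tendsto_one_add_log_rangeY_div.const_mul (4 * (M : ℝ) ^ 2)).const_add 1).add
      (tendsto_rangeJ_sq_div_rangeY.const_mul (64 * (M : ℝ) ^ 3))).add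
      ((hl.mul (hl.const_add 2)).const_mul 8))
  have h' := h.add ((tendsto_self_div_mul.const_mul (4 * (M : ℝ) ^ 3)).add
    (tendsto_self_mul_rangeJ_sq_div.const_mul (64 * (M : ℝ) ^ 5)))
  simp only [mul_zero, add_zero, one_mul] at h'
  refine h'.congr fun X => ?_
  unfold energyRatio
  simp only [mul_div_assoc]

lemma tendsto_defect {M k : ℕ} (w : ℕ) (hM : 0 < M) (hk : 0 < k) :
    Tendsto (fun X : ℕ => defect M w X (rangeY X) (X / k) (rangeJ X)) atTop
      (𝓝 (1 + 1 / k / 2 - 1 / (1 + 8 * (1 / w * (2 + 1 / w))))) := by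
  have hE := tendsto_energyRatio w hM hk
  have hne : (1 + 8 * (1 / w * (2 + 1 / w)) : ℝ) ≠ 0 := by positivity
  have hZ := tendsto_natCast_inv (tendsto_div_nat hk)
  have hX : Tendsto (fun X : ℕ => (1 : ℝ) / X) atTop (𝓝 0) := tendsto_one_div_atTop_nhds_zero_nat
  have hρ := (((hZ.const_mul (2 * (M : ℝ))).const_sub 1).mul
    (((tendsto_natCast_inv tendsto_rangeY).const_mul (M : ℝ)).const_sub 1)).pow 2
  have h3 := (((hX.mul hZ).add (tendsto_rangeY_div_self.mul (tendsto_rangeY_div_div hk))).add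
    (((tendsto_rangeJ_sq_div_rangeY.mul tendsto_rangeY_div_self).mul hZ).const_mul
      (4 * (M : ℝ) ^ 2))).const_mul (M : ℝ)
  have h := ((((tendsto_div_nat_ratio hk).div_const 2).const_add 1).sub (hρ.div hE hne)).add h3
  simp only [mul_zero, add_zero, sub_zero, mul_one, one_pow] at h
  refine h.congr' ?_
  filter_upwards [eventually_parameters_pos] with X ⟨h1, _, _, h4, _⟩
  unfold defect
  simp only [Pi.div_apply]
  congr 1
  · congr 1
    · rw [div_div, mul_comm (X : ℝ) 2]
    · rw [mul_one_div, mul_one_div]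
  · congr 2
    · rw [one_div_mul_one_div, div_mul_div_comm, sq]
    · congr 1
      rw [mul_one_div, div_mul_div_cancel₀ h4.ne', div_div]

/-! ### From blocks to all integers -/

open Classical in
-- Strong induction on N: take the least X whose block reaches N and recurse at X². Minimality gives
-- X² + X(X/k) ≤ N, so the block's allowance is paid for by N − X². Small N go into the constant.
lemma card_le_of_block_bounds (B : ℕ → Prop) {ε : ℝ} (hε : 0 ≤ ε) {k X₁ : ℕ} (hk : 0 < k)
    (h : ∀ X ≥ X₁, (((Finset.Ioc (X ^ 2) ((X + X / k) ^ 2)).filter B).card : ℝ)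
      ≤ ε * (X * (X / k : ℕ))) :
    ∃ C : ℝ, ∀ N : ℕ, (((Finset.Ioc 0 N).filter B).card : ℝ) ≤ C + ε * N := by
  set X₂ := max X₁ (4 * k) with hX₂
  refine ⟨((2 * X₂) ^ 2 : ℕ), fun N => ?_⟩
  induction N using Nat.strong_induction_on with
  | _ N ih =>
  rcases le_or_gt N ((2 * X₂) ^ 2) with hN | hN
  · have h1 : ((Finset.Ioc 0 N).filter B).card ≤ (2 * X₂) ^ 2 :=
      (Finset.card_filter_le _ _).trans (by simpa using hN)
    have h2 : (((Finset.Ioc 0 N).filter B).card : ℝ) ≤ ((2 * X₂) ^ 2 : ℕ) := by exact_mod_cast h1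
    have : 0 ≤ ε * N := by positivity
    linarith
  · have hex : ∃ X, N ≤ (X + X / k) ^ 2 := ⟨N, by nlinarith [Nat.zero_le (N / k)]⟩
    set X := Nat.find hex with hX
    have hXN : N ≤ (X + X / k) ^ 2 := Nat.find_spec hex
    have hlt : X₂ < X := by
      by_contra! hle
      have h1 : X + X / k ≤ 2 * X₂ := by
        have := Nat.div_le_self X k
        omega
      exact absurd (hXN.trans (Nat.pow_le_pow_left h1 2)) (by omega)
    have hX1 : X₁ ≤ X := (le_max_left _ _).trans hlt.le
    have hX4 : 4 * k ≤ X := (le_max_right _ _).trans hlt.le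
    have hZ4 : 4 ≤ X / k := (Nat.le_div_iff_mul_le hk).2 hX4
    have hmin : (X - 1 + (X - 1) / k) ^ 2 < N := by
      have := Nat.find_min hex (m := X - 1) (by omega)
      omega
    have hdiv : X / k ≤ (X - 1) / k + 1 := by
      rw [← Nat.add_div_right _ hk]
      exact Nat.div_le_div_right (by omega)
    obtain ⟨c, hc⟩ : ∃ c, X / k = c + 2 := ⟨X / k - 2, by omega⟩
    -- With X/k = c + 2, failure at X − 1 gives N > (X + c)², and c ≥ 2 makes 2cX at least (c + 2)X.
    have hlow : X ^ 2 + X * (X / k) ≤ N := by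
      have h1 : X + c ≤ X - 1 + (X - 1) / k := by omega
      have h2 := (Nat.pow_le_pow_left h1 2).trans hmin.le
      rw [hc]
      have : X * 2 ≤ X * c := Nat.mul_le_mul_left X (by omega)
      nlinarith [Nat.zero_le (c ^ 2)]
    have hXlt : X ^ 2 < N := by
      have : 0 < X * (X / k) := Nat.mul_pos (by omega) (by omega)
      omega
    have h1 := ih (X ^ 2) hXlt
    have h2 := h X hX1
    have h3 : ((Finset.Ioc 0 N).filter B).card ≤ ((Finset.Ioc 0 (X ^ 2)).filter B).card
        + ((Finset.Ioc (X ^ 2) ((X + X / k) ^ 2)).filter B).card := by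
      refine (Finset.card_le_card ?_).trans (Finset.card_union_le _ _)
      intro n
      simp only [Finset.mem_union, Finset.mem_filter, Finset.mem_Ioc]
      rintro ⟨⟨h0, hn⟩, hB⟩
      rcases le_or_gt n (X ^ 2) with h | h
      · exact Or.inl ⟨⟨h0, h⟩, hB⟩
      · exact Or.inr ⟨⟨h, hn.trans hXN⟩, hB⟩
    have h3' : (((Finset.Ioc 0 N).filter B).card : ℝ) ≤ ((Finset.Ioc 0 (X ^ 2)).filter B).card
        + ((Finset.Ioc (X ^ 2) ((X + X / k) ^ 2)).filter B).card := by exact_mod_cast h3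
    have h4 : ε * ((X : ℝ) ^ 2 + X * (X / k : ℕ)) ≤ ε * N :=
      mul_le_mul_of_nonneg_left (by exact_mod_cast hlow) hε
    push_cast at h1 h2 h3' h4 ⊢
    linarith

open Classical in
lemma countUpTo_eq_card_filter (A : Set ℕ) (N : ℕ) :
    countUpTo A N = ((Finset.Ioc 0 N).filter (fun n => n ∈ A)).card := by
  rw [countUpTo, ← Set.ncard_coe_finset]
  congr 1
  ext n
  simp only [Set.mem_ofPred_eq, Finset.coe_filter, Finset.mem_Ioc]
  constructor
  · rintro ⟨h, h1, h2⟩; exact ⟨⟨h1, h2⟩, h⟩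
  · rintro ⟨⟨h1, h2⟩, h⟩; exact ⟨h, h1, h2⟩

lemma le_countUpTo_eligible (N : ℕ) : (N : ℝ) / 8 - 1 ≤ countUpTo eligible N := by
  classical
  have h := le_card_Ioc_modEq 0 N 8 1 (by norm_num)
  rw [zero_add] at h
  rw [countUpTo_eq_card_filter]
  have hsub : (Finset.Ioc 0 N).filter (fun n => n ≡ 1 [MOD 8]) ⊆
      (Finset.Ioc 0 N).filter (fun n => n ∈ eligible) := by
    intro n hn
    obtain ⟨h0, h1⟩ := Finset.mem_filter.1 hn
    rw [Finset.mem_Ioc] at h0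
    refine Finset.mem_filter.2 ⟨Finset.mem_Ioc.2 h0, h0.1, ?_, ?_⟩ <;>
      simp only [Nat.ModEq] at * <;> omega
  have h' := h.trans (Nat.cast_le.2 (Finset.card_le_card hsub))
  push_cast at h'
  convert h'

lemma HasMicrosquareRep.mono {n : ℕ} {Y Y' : ℝ} (h : HasMicrosquareRep n Y) (hY : Y ≤ Y') :
    HasMicrosquareRep n Y' := by
  obtain ⟨x₁, x₂, x₃, h1, h2, h3, h4, h5⟩ := h
  exact ⟨x₁, x₂, x₃, h1, h2, h3, h4, h5.trans hY⟩

/-- Eligible integers without a representation with a small third square. -/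
def IsExceptional (ε : ℝ) (n : ℕ) : Prop :=
  n ∈ eligible ∧ ¬ HasMicrosquareRep n (Real.log n * Real.log (Real.log n) ^ (2 + ε))

/-- One factor log log X is already in J and a second eventually exceeds the constant 2M, so
exponent 2 suffices. -/
lemma eventually_le_threshold (M : ℕ) {ε : ℝ} (hε : 0 ≤ ε) :
    ∀ᶠ X : ℕ in atTop, ∀ n : ℕ, X ^ 2 < n →
      ((2 * M * rangeJ X : ℕ) : ℝ) ≤ Real.log n * Real.log (Real.log n) ^ (2 + ε) := by
  filter_upwards [eventually_parameters_pos, tendsto_log_log_natCast.eventually_ge_atTop 1,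
    tendsto_log_log_natCast.eventually_ge_atTop (2 * M : ℝ)] with X ⟨h1, h2, h3, _, _⟩ h4 h5 n hn
  have hXn : (X : ℝ) ≤ n := by
    have : X ≤ n := (Nat.le_self_pow (by norm_num) X).trans hn.le
    exact_mod_cast this
  have hlog : Real.log X ≤ Real.log n := Real.log_le_log h1 hXn
  have hloglog : Real.log (Real.log X) ≤ Real.log (Real.log n) := Real.log_le_log h2 hlog
  have hJ : (rangeJ X : ℝ) ≤ Real.log X * Real.log (Real.log X) :=
    Nat.floor_le (mul_nonneg h2.le h3.le)
  push_cast
  calc (2 * M * rangeJ X : ℝ)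
      ≤ Real.log (Real.log X) * (Real.log X * Real.log (Real.log X)) := by gcongr
    _ = Real.log X * Real.log (Real.log X) ^ (2 : ℝ) := by
        rw [Real.rpow_two]; ring
    _ ≤ Real.log n * Real.log (Real.log n) ^ (2 + ε) := by
        gcongr ?_ * ?_
        calc Real.log (Real.log X) ^ (2 : ℝ) ≤ Real.log (Real.log X) ^ (2 + ε) :=
              Real.rpow_le_rpow_of_exponent_le h4 (by linarith)
          _ ≤ _ := Real.rpow_le_rpow h3.le hloglog (by linarith)

open Classical in
lemma eventually_card_exceptional_le {ε δ : ℝ} (hε : 0 ≤ ε) (hδ : 0 < δ) :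
    ∃ k : ℕ, 0 < k ∧ ∀ᶠ X : ℕ in atTop,
      (((Finset.Ioc (X ^ 2) ((X + X / k) ^ 2)).filter (IsExceptional ε)).card : ℝ)
        ≤ δ * (X * (X / k : ℕ)) := by
  obtain ⟨k, hk, w, hw, hkw⟩ : ∃ k : ℕ, 0 < k ∧ ∃ w : ℕ, 1 ≤ w ∧
      (1 + 1 / k / 2 - 1 / (1 + 8 * (1 / w * (2 + 1 / w))) : ℝ) < δ / 2 := by
    have hlim : Tendsto (fun m : ℕ =>
        (1 + 1 / (m : ℝ) / 2 - 1 / (1 + 8 * (1 / m * (2 + 1 / m))) : ℝ)) atTop (𝓝 0) := by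
      have h0 : Tendsto (fun m : ℕ => (1 : ℝ) / m) atTop (𝓝 0) :=
        tendsto_one_div_atTop_nhds_zero_nat
      have := ((h0.div_const 2).const_add 1).sub
        ((tendsto_const_nhds (x := (1 : ℝ))).div
          (((h0.mul (h0.const_add 2)).const_mul 8).const_add 1) (by norm_num))
      simpa using this
    obtain ⟨m, hm, hm1⟩ := ((hlim.eventually_lt_const (by positivity : 0 < δ / 2)).and
      (eventually_ge_atTop 1)).exists
    -- A single large m serves as both k and w.
    exact ⟨m, hm1, m, hm1, hm⟩
  refine ⟨k, hk, ?_⟩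
  obtain ⟨M, hMeq⟩ : ∃ M, sieveModulus w = 2 * M :=
    ⟨4 * ∏ p ∈ (Finset.Icc 3 w).filter Nat.Prime, p, by unfold sieveModulus; ring⟩
  have h4 : 4 ∣ M := by
    refine ⟨∏ p ∈ (Finset.Icc 3 w).filter Nat.Prime, p, ?_⟩
    have : 2 * M = 2 * (4 * ∏ p ∈ (Finset.Icc 3 w).filter Nat.Prime, p) := by
      rw [← hMeq, sieveModulus]; ring
    omega
  have hM : 0 < M := by have := sieveModulus_pos w; omega
  have hMr : (0 : ℝ) < M := by exact_mod_cast hM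
  have hwM : ∀ d : ℕ, 1 < d → d.Coprime M → w < d := by
    intro d hd hc
    apply lt_of_coprime_sieveModulus hd
    rw [hMeq]
    exact Nat.Coprime.mul_right
      (Nat.Coprime.coprime_dvd_right ((by norm_num : (2 : ℕ) ∣ 4).trans h4) hc) hc
  filter_upwards [(tendsto_defect w hM hk).eventually_le_const hkw, eventually_gt_atTop 0,
    tendsto_rangeY.eventually_ge_atTop M, (tendsto_div_nat hk).eventually_ge_atTop (2 * M),
    tendsto_rangeJ.eventually_gt_atTop 0, eventually_le_threshold M hε]
    with X hdef hX hY hZ hJ hthr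
  have hclass : ∀ a ∈ Finset.range (2 * M),
      (((Finset.Ioc (X ^ 2) ((X + X / k) ^ 2)).filter
        (fun n => n % (2 * M) = a ∧ IsExceptional ε n)).card : ℝ)
      ≤ X * (X / k : ℕ) / M * (δ / 2) := by
    intro a ha
    rcases ((Finset.Ioc (X ^ 2) ((X + X / k) ^ 2)).filter
        (fun n => n % (2 * M) = a ∧ IsExceptional ε n)).eq_empty_or_nonempty with he | ⟨n, hn⟩
    · rw [he, Finset.card_empty, Nat.cast_zero]
      positivity
    -- One exceptional n in the class is eligible, and its local solution supplies x₀, y₀ and h for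
    -- the whole class.
    · obtain ⟨-, hna, hnE, -⟩ := Finset.mem_filter.1 hn
      obtain ⟨x₀, y₀, h', hsol, hcop⟩ := locallySoluble_sieveModulus w hnE
      rw [hMeq] at hsol hcop
      -- Residue 0 is represented by 2M, since the third variable must be positive.
      obtain ⟨h, hh, hhM, hmod⟩ : ∃ h, 1 ≤ h ∧ h ≤ 2 * M ∧ h ≡ h' [MOD 2 * M] := by
        rcases Nat.eq_zero_or_pos (h' % (2 * M)) with h0 | h0
        · exact ⟨2 * M, by omega, le_rfl, by rw [Nat.ModEq, h0, Nat.mod_self]⟩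
        · exact ⟨h' % (2 * M), h0, (Nat.mod_lt _ (by omega)).le, Nat.mod_modEq _ _⟩
      have hsol' : x₀ ^ 2 + y₀ ^ 2 + h ^ 2 ≡ n [MOD 2 * M] :=
        ((hmod.pow 2).add_left _).trans hsol
      have key := card_unrepresented_le (Y := rangeY X) (Z := X / k) (J := rangeJ X) h4 hM hX hY
        hZ hJ hw hwM hh hhM hcop.coprime_mul_left_right hsol'
      calc _ ≤ (((Finset.Ioc (X ^ 2) ((X + X / k) ^ 2)).filter (fun m => m ≡ n [MOD 2 * M] ∧
            ¬ HasMicrosquareRep m (2 * M * rangeJ X : ℕ))).card : ℝ) := by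
            norm_cast
            apply Finset.card_le_card
            intro m hm
            obtain ⟨hm1, hm2, -, hm3⟩ := Finset.mem_filter.1 hm
            refine Finset.mem_filter.2 ⟨hm1, hm2.trans hna.symm, fun hrep => hm3 ?_⟩
            exact hrep.mono (hthr m (Finset.mem_Ioc.1 hm1).1)
        _ ≤ _ := key.trans (mul_le_mul_of_nonneg_left hdef (by positivity))
  have hfib : ((Finset.Ioc (X ^ 2) ((X + X / k) ^ 2)).filter (IsExceptional ε)).card
      = ∑ a ∈ Finset.range (2 * M), ((Finset.Ioc (X ^ 2) ((X + X / k) ^ 2)).filter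
        (fun n => n % (2 * M) = a ∧ IsExceptional ε n)).card := by
    rw [Finset.card_eq_sum_card_fiberwise (f := fun n => n % (2 * M))
      (t := Finset.range (2 * M))]
    · refine Finset.sum_congr rfl fun a _ => ?_
      rw [Finset.filter_filter]
      congr 1
      ext n
      simp only [Finset.mem_filter]
      tauto
    · intro n _
      exact Finset.mem_coe.2 (Finset.mem_range.2 (Nat.mod_lt _ (by omega)))
  rw [hfib]
  push_cast
  refine (Finset.sum_le_sum hclass).trans (le_of_eq ?_)
  rw [Finset.sum_const, Finset.card_range, nsmul_eq_mul]
  push_cast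
  field_simp

theorem corollary1p3 (ε : ℝ) (hε : 0 < ε) :
    ForAlmostAll eligible (fun n =>
      HasMicrosquareRep n (Real.log n * Real.log (Real.log n) ^ (2 + ε))) := by
  classical
  rw [ForAlmostAll, Metric.tendsto_atTop']
  intro η hη
  -- Eligible integers number at least N/8 − 1, so η/32 leaves room for the constants C and η.
  obtain ⟨k, hk, hev⟩ := eventually_card_exceptional_le hε.le (by positivity : 0 < η / 32)
  obtain ⟨X₁, hX₁⟩ := eventually_atTop.1 hev
  obtain ⟨C, hC⟩ := card_le_of_block_bounds (IsExceptional ε) (by positivity) hk hX₁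
  obtain ⟨N₀, hN₀⟩ := exists_nat_gt (max 16 ((C + η) * 32 / η))
  refine ⟨N₀, fun N hN => ?_⟩
  have hN' : max 16 ((C + η) * 32 / η) < (N : ℝ) := hN₀.trans (by exact_mod_cast hN)
  obtain ⟨h16, hCN⟩ := max_lt_iff.1 hN'
  rw [div_lt_iff₀ hη] at hCN
  have hlow := le_countUpTo_eligible N
  have hpos : (0 : ℝ) < countUpTo eligible N := by linarith
  have hup : (countUpTo {n | n ∈ eligible ∧ ¬ HasMicrosquareRep n
      (Real.log n * Real.log (Real.log n) ^ (2 + ε))} N : ℝ) ≤ C + η / 32 * N := by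
    rw [countUpTo_eq_card_filter]
    exact hC N
  rw [Real.dist_eq, sub_zero, abs_of_nonneg (by positivity), div_lt_iff₀ hpos]
  have := mul_le_mul_of_nonneg_left hlow hη.le
  nlinarith
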